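/- Consider the noncoherent full-duplex 2-relay diamond network with coherence time $T$: in every block of $T$ symbols, relay $i\in\{1,2\}$ receives $Y_{R_i}=g_{\mathrm{sr}i}X_S+W_{R_i}$ and the destination receives $Y_D=g_{\mathrm{rd}1}X_{R_1}+g_{\mathrm{rd}2}X_{R_2}+W_D$, where the noises are i.i.d. $\mathcal{CN}(0,1)$, the gains are constant within a block, independent over links and blocks, with $g_{\mathrm{sr}i}\sim\mathcal{CN}(0,\rho_{\mathrm{sr}i}^2)$, $g_{\mathrm{rd}i}\sim\mathcal{CN}(0,\rho_{\mathrm{rd}i}^2)$, $\rho_{\mathrm{sr}i}^2=\mathsf{SNR}^{\gamma_{\mathrm{sr}i}}$, $\rho_{\mathrm{rd}i}^2=\mathsf{SNR}^{\gamma_{\mathrm{rd}i}}$. Each relay symbol is a function of the symbols received earlier at that relay, and each transmitter has average power at most $1$ per symbol. The gDoF of a class of block codes is $\limsup_{\mathsf{SNR}\to\infty}C(\mathsf{SNR})/\log_2\mathsf{SNR}$, where $C(\mathsf{SNR})$ is the supremum of the rates (bits per symbol) achievable, with vanishing average error probability as the number of blocks grows, by codes of the class. A code using a fixed nonempty set $S$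 of relays (the other relay never transmits) is a standard training-based scheme if in every block the source sends fixed (message-independent) pilots, not all zero, in some symbol times, and the relays in $S$ send fixed pilots in some common symbol times such that the $|S|$ pilot sequences are linearly independent (so that the destination can learn $|S|$ independent combinations of its gains); apart from this the code is arbitrary, and all nodes may even be given perfect knowledge of all gains. Relay selection means a code in which no node is given the gains and one fixed relay never transmits. The gDoF upper bound is $\lim_{\mathsf{SNR}\to\infty}\min\{(T-1)\log_2\rho_{\mathrm{sr}1}^2,(\mathcal P_1)\}/\log_2\mathsf{SNR}$ (a bound on $T$ times the gDoF of the network), where $(\mathcal P_1)$ is the supremum of $\min\{\psi_1,(T-1)\log_2\rho_{\mathrm{sr}2}^2+\psi_2\}$ over all joint laws of complex random variables $(x_2,x_{11},x_{12})$ with $\mathbb E|x_2|^2\le T$, $\mathbb E[|x_{11}|^2+|x_{12}|^2]\le T$, and, with $a=\rho_{\mathrm{rd}2}^2|x_2|^2$, $b=\rho_{\mathrm{rd}1}^2|x_{11}|^2$, $c=\rho_{\mathrm{rd}1}^2|x_{12}|^2$, $$\psi_1=T\,\mathbb E\log_2(a+b+c+T)-\mathbb E\log_2(a+b+c+ac+1),$$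 $$\psi_2=\mathbb E\log_2(a+b+1)+(T-1)\,\mathbb E\log_2(c+T-1)-\mathbb E\log_2(a+b+c+ac+1).$$ Theorem. There are regimes of the network where standard training-based schemes cannot reach this upper bound. For example, let $T=3$, $\gamma_{\mathrm{sr}1}=4$, $\gamma_{\mathrm{sr}2}=1$, $\gamma_{\mathrm{rd}1}=2$, $\gamma_{\mathrm{rd}2}=3$. Then the limit defining the upper bound exists and equals $14/3\approx4.67$, while $T$ times the gDoF of standard training-based schemes is at most $4$ for schemes using a single relay, at most $3$ for schemes using both relays, and, for the class of all standard training-based schemes, strictly less than $14/3$. In the same example, $T$ times the gDoF of relay selection (with or without training) is at most $4$, hence strictly less than $14/3$. -/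

import Mathlib

open MeasureTheory ProbabilityTheory Filter Topology
open scoped ENNReal NNReal

noncomputable section

namespace Diamond

/-- The circularly symmetric complex Gaussian distribution `CN(0, v)`: real and imaginary part are
independent centred real Gaussians of variance `v / 2`. -/
def complexGaussian (v : ℝ≥0) : Measure ℂ :=
  ((gaussianReal 0 (v / 2)).prod (gaussianReal 0 (v / 2))).map (fun p => (⟨p.1, p.2⟩ : ℂ))

/-- SNR-exponents of the four links; index `0` is the first relay and index `1` the second one.
`sr i` is the link from the source to relay `i`, `rd i` the link from relay `i` to the
destination. -/
structure LinkExponents where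
  sr : Fin 2 → ℝ
  rd : Fin 2 → ℝ

/-- The strength `ρ² = SNR ^ γ` (mean of the squared fading gain) of a link with exponent `γ`. -/
def strength (snr γ : ℝ) : ℝ≥0 := (snr ^ γ).toNNReal

/-- Symbols at one node over `n` blocks of `T` symbol durations each. -/
abbrev Signal (n T : ℕ) := Fin n → Fin T → ℂ

/-- Fading gains in `n` blocks: `(g.1 i b, g.2 i b)` are the gains of the link from the source to
relay `i` and of the link from relay `i` to the destination in block `b`. They are constant within
a block. -/
abbrev Fading (n : ℕ) := (Fin 2 → Fin n → ℂ) × (Fin 2 → Fin n → ℂ)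

/-- Additive noise at the two relays and at the destination. -/
abbrev Noise (n T : ℕ) := (Fin 2 → Signal n T) × Signal n T

/-- Law of the fading: independent over links and blocks, `CN(0, SNR ^ γ)` on a link of
exponent `γ`. -/
def fadingLaw (γ : LinkExponents) (snr : ℝ) (n : ℕ) : Measure (Fading n) :=
  (Measure.pi fun i => Measure.pi fun _ => complexGaussian (strength snr (γ.sr i))).prod
    (Measure.pi fun i => Measure.pi fun _ => complexGaussian (strength snr (γ.rd i)))

/-- Law of the noise: all entries i.i.d. `CN(0, 1)`. -/
def noiseLaw (n T : ℕ) : Measure (Noise n T) :=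
  (Measure.pi fun _ => Measure.pi fun _ => Measure.pi fun _ => complexGaussian 1).prod
    (Measure.pi fun _ => Measure.pi fun _ => complexGaussian 1)

/-- Joint law of fading and noise. -/
def channelLaw (γ : LinkExponents) (snr : ℝ) (n T : ℕ) : Measure (Fading n × Noise n T) :=
  (fadingLaw γ snr n).prod (noiseLaw n T)

/-- A block code with `M` messages over `n` fading blocks for the full-duplex two-relay diamond
network. The first argument of the maps offers the nodes the fading gains of the whole network;
codes without channel knowledge are those which ignore it (`Code.Noncoherent`). A relay's symbol
depends only on the symbols that this relay received strictly earlier, in earlier blocks or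
earlier in the same block. -/
structure Code (n T M : ℕ) where
  source : Fading n → Fin M → Signal n T
  relay : Fin 2 → Fading n → Signal n T → Signal n T
  decode : Fading n → Signal n T → Fin M
  measurable_source : ∀ m, Measurable fun g => source g m
  measurable_relay : ∀ i, Measurable fun p : Fading n × Signal n T => relay i p.1 p.2
  measurable_decode : Measurable fun p : Fading n × Signal n T => decode p.1 p.2
  causal : ∀ (i : Fin 2) (g : Fading n) (y y' : Signal n T) (b : Fin n) (t : Fin T),
    (∀ b' t', (b' < b ∨ (b' = b ∧ t' < t)) → y b' t' = y' b' t') →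
      relay i g y b t = relay i g y' b t

namespace Code

variable {n T M : ℕ}

/-- Received signal at relay `i`: `Y_{R_i} = g_{sr i} X_S + W_{R_i}` in every block. -/
def relayInput (c : Code n T M) (m : Fin M) (ω : Fading n × Noise n T) (i : Fin 2) :
    Signal n T :=
  fun b t => ω.1.1 i b * c.source ω.1 m b t + ω.2.1 i b t

/-- Signal transmitted by relay `i`. -/
def relayOutput (c : Code n T M) (m : Fin M) (ω : Fading n × Noise n T) (i : Fin 2) :
    Signal n T :=
  c.relay i ω.1 (c.relayInput m ω i)

/-- Received signal at the destination: `Y_D = g_{rd 1} X_{R_1} + g_{rd 2} X_{R_2} + W_D` in every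
block. -/
def destInput (c : Code n T M) (m : Fin M) (ω : Fading n × Noise n T) : Signal n T :=
  fun b t => (∑ i, ω.1.2 i b * c.relayOutput m ω i b t) + ω.2.2 b t

/-- Probability of a decoding error, for a uniformly distributed message. -/
def errorProb (c : Code n T M) (γ : LinkExponents) (snr : ℝ) : ℝ≥0∞ :=
  (∑ m, channelLaw γ snr n T {ω | c.decode ω.1 (c.destInput m ω) ≠ m}) / M

/-- Average power constraint: each of the three transmitters uses at most unit power per symbol,
on average over time, messages, fading and noise. -/
def PowerConstraint (c : Code n T M) (γ : LinkExponents) (snr : ℝ) : Prop :=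
  (∑ m, ∑ b, ∑ t, ∫⁻ ω, ‖c.source ω.1 m b t‖ₑ ^ 2 ∂(channelLaw γ snr n T)
      ≤ (M : ℝ≥0∞) * (n * T)) ∧
  ∀ i, ∑ m, ∑ b, ∑ t, ∫⁻ ω, ‖c.relayOutput m ω i b t‖ₑ ^ 2 ∂(channelLaw γ snr n T)
      ≤ (M : ℝ≥0∞) * (n * T)

/-- No node uses knowledge of the fading gains. -/
def Noncoherent (c : Code n T M) : Prop :=
  ∀ g g', c.source g = c.source g' ∧ (∀ i, c.relay i g = c.relay i g') ∧ c.decode g = c.decode g'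

/-- Relay `i` never transmits. -/
def Silent (c : Code n T M) (i : Fin 2) : Prop :=
  ∀ g y b t, c.relay i g y b t = 0

/-- In every block, the source sets aside symbols for pilots (fixed, not identically zero, and
independent of the message), from which each relay can learn its single incoming gain. -/
def SourceTrains (c : Code n T M) : Prop :=
  ∀ b, ∃ (P : Finset (Fin T)) (p : Fin T → ℂ), (∃ t ∈ P, p t ≠ 0) ∧
    ∀ g m, ∀ t ∈ P, c.source g m b t = p t

/-- In every block, the relays in `S` set aside common symbol times for fixed pilots, from which
the destination can learn as many independent combinations of the gains of its incoming links as
there are links from relays in `S`. -/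
def RelaysTrain (c : Code n T M) (S : Finset (Fin 2)) : Prop :=
  ∀ b, ∃ (P : Finset (Fin T)) (p : Fin 2 → Fin T → ℂ),
    LinearIndependent ℂ (fun (i : S) (t : P) => p i t) ∧
    ∀ i ∈ S, ∀ g y, ∀ t ∈ P, c.relay i g y b t = p i t

/-- Standard training-based schemes that use exactly the relays in `S`: the gains of all links in
use are trained by separate pilot symbols in every block; the other symbols are used freely, and
every node may even rely on perfect knowledge of the gains. -/
def Training (S : Finset (Fin 2)) (c : Code n T M) : Prop :=
  (∀ i ∉ S, c.Silent i) ∧ c.SourceTrains ∧ c.RelaysTrain S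

/-- Standard training-based schemes that use a single relay. -/
def SingleRelayTraining (c : Code n T M) : Prop := ∃ i, c.Training {i}

/-- Standard training-based schemes that use both relays. -/
def TwoRelayTraining (c : Code n T M) : Prop := c.Training Finset.univ

/-- Standard training-based schemes. -/
def StandardTraining (c : Code n T M) : Prop := c.SingleRelayTraining ∨ c.TwoRelayTraining

/-- Relay selection: only one relay ever transmits, and there is no channel knowledge other than
what the nodes infer from the symbols they receive (with or without pilots). -/
def RelaySelection (c : Code n T M) : Prop := c.Noncoherent ∧ ∃ i, c.Silent i

end Code

/-- The rate `R` (bits per symbol) is achieved by codes in the class `K`: for all large `n` there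
are codes in `K` over `n` blocks with at least `2 ^ (n T R)` messages, which obey the power
constraint and whose error probability tends to `0`. -/
def Achievable (T : ℕ) (γ : LinkExponents) (K : ∀ n M : ℕ, Code n T M → Prop) (snr : ℝ)
    (R : ℝ≥0) : Prop :=
  ∀ ε : ℝ≥0∞, 0 < ε → ∀ᶠ n : ℕ in atTop, ∃ (M : ℕ) (c : Code n T M),
    (2 : ℝ) ^ ((n : ℝ) * T * R) ≤ M ∧ K n M c ∧ c.PowerConstraint γ snr ∧ c.errorProb γ snr ≤ ε

/-- Supremum of the rates achieved by codes in the class `K`. -/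
def capacity (T : ℕ) (γ : LinkExponents) (K : ∀ n M : ℕ, Code n T M → Prop) (snr : ℝ) : ℝ≥0∞ :=
  ⨆ (R : ℝ≥0) (_ : Achievable T γ K snr R), (R : ℝ≥0∞)

/-- The generalized degrees of freedom of the class `K`, the growth rate of its capacity relative
to `log SNR`. The upper limit is used, so that no existence of a limit is presupposed. -/
def gDoF (T : ℕ) (γ : LinkExponents) (K : ∀ n M : ℕ, Code n T M → Prop) : ℝ≥0∞ :=
  limsup (fun snr : ℝ => capacity T γ K snr / ENNReal.ofReal (Real.logb 2 snr)) atTop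

/-- `ψ₁`, for link strengths `s₁ = ρ_{rd 1}²`, `s₂ = ρ_{rd 2}²` and a joint law `p` of
`x = (x_{r2}, x_{r11}, x_{r12})`. -/
def psi1 (T : ℕ) (s₁ s₂ : ℝ) (p : Measure (ℂ × ℂ × ℂ)) : ℝ :=
  T * ∫ x, Real.logb 2 (s₂ * ‖x.1‖ ^ 2 + s₁ * ‖x.2.1‖ ^ 2 + s₁ * ‖x.2.2‖ ^ 2 + T) ∂p
  - ∫ x, Real.logb 2 (s₂ * ‖x.1‖ ^ 2 + s₁ * ‖x.2.1‖ ^ 2 + s₁ * ‖x.2.2‖ ^ 2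
      + s₁ * s₂ * ‖x.2.2‖ ^ 2 * ‖x.1‖ ^ 2 + 1) ∂p

/-- `ψ₂`, with the same conventions. -/
def psi2 (T : ℕ) (s₁ s₂ : ℝ) (p : Measure (ℂ × ℂ × ℂ)) : ℝ :=
  ∫ x, Real.logb 2 (s₂ * ‖x.1‖ ^ 2 + s₁ * ‖x.2.1‖ ^ 2 + 1) ∂p
  + ((T : ℝ) - 1) * ∫ x, Real.logb 2 (s₁ * ‖x.2.2‖ ^ 2 + ((T : ℝ) - 1)) ∂p
  - ∫ x, Real.logb 2 (s₂ * ‖x.1‖ ^ 2 + s₁ * ‖x.2.1‖ ^ 2 + s₁ * ‖x.2.2‖ ^ 2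
      + s₁ * s₂ * ‖x.2.2‖ ^ 2 * ‖x.1‖ ^ 2 + 1) ∂p

/-- Feasible laws of `(x_{r2}, x_{r11}, x_{r12})`: `E|x_{r2}|² ≤ T` and
`E[|x_{r11}|² + |x_{r12}|²] ≤ T`. -/
def Feasible (T : ℕ) (p : Measure (ℂ × ℂ × ℂ)) : Prop :=
  IsProbabilityMeasure p ∧ ∫⁻ x, ‖x.1‖ₑ ^ 2 ∂p ≤ T ∧
    ∫⁻ x, (‖x.2.1‖ₑ ^ 2 + ‖x.2.2‖ₑ ^ 2) ∂p ≤ T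

/-- Optimal value of the problem to maximize
`min {ψ₁, (T - 1) log ρ_{sr 2}² + ψ₂}` over all feasible laws. -/
def optP1 (T : ℕ) (γ : LinkExponents) (snr : ℝ) : ℝ :=
  sSup {r | ∃ p, Feasible T p ∧
    r = min (psi1 T (snr ^ γ.rd 0) (snr ^ γ.rd 1) p)
      (((T : ℝ) - 1) * Real.logb 2 (snr ^ γ.sr 1) + psi2 T (snr ^ γ.rd 0) (snr ^ γ.rd 1) p)}

/-- The upper bound `min {(T - 1) log ρ_{sr 1}², (P₁)}` on `T` times the capacity. -/
def upperBound (T : ℕ) (γ : LinkExponents) (snr : ℝ) : ℝ :=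
  min (((T : ℝ) - 1) * Real.logb 2 (snr ^ γ.sr 0)) (optP1 T γ snr)

end Diamond

end

/-! Upper bounds on the gDoF come from a change of measure. Let `ℓ` be the logarithm of the ratio
between the output density given a message (or a bound for it) and a reference density `Q` that does
not depend on the message. On `{ℓ ≤ L}`, message `m` is decoded correctly with probability at most
`exp L * Q(dec = m)`. Decoding regions are disjoint, so these bounds sum to at most `exp L`; the
event `{ℓ > L}` is handled by Markov's inequality. This yields the inequality in `ConverseBound`,
valid for every `L > 0`. Taking `L` linear in the number of blocks, `Achievable.rate_le` turns it
into a bound on the rate and `ConverseBound.mul_gDoF_le` into one on the gDoF.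

The reference is heavy-tailed, proportional to `(1 + ‖y‖²)^(-r)` with `r` just above half the real
dimension, so `ℓ` grows only logarithmically in the received power and its mean needs only second
moments. Three cuts are used. Known gains with pilots (`converseBound_training`): a pilot output is
Gaussian with a mean fixed by the gains, so it costs nothing. Each of the at most `T - |S|` free
symbols costs `Γ log SNR`, which gives `2 * 2 = 4` for relay 1 and `1 * 3 = 3` for both relays.
Relay 1 silent (`converseBound_silent_zero`): everything passes through the link to relay 2, which
gives `3 * 1 = 3`. Only relay 1 active, gains unknown (`converseBound_noncoherent`): averaging over
the gain bounds the block density by `1 / (1 + s‖x‖²)`, which cancels one of the `T` logarithms and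
leaves `(T - 1) * 2 = 4`.

The value `14/3` comes from linear programming duality. Weighting the two objectives by `2/3` and
`1/3` makes the pointwise integrand at most `4 log SNR` up to constants and power terms
(`log_objective_le`); the source link adds `1/3 * 2`. Conversely, time sharing between `(1, 0, 0)`
and `(0, 1, 1)` with probabilities `1/3` and `2/3` raises both objectives to `14/3`
(`le_min_objective_mixedLaw`). -/

noncomputable section

namespace Diamond

/-! ### Product measures: factorized integrals and densities. -/

section Products

variable {n : ℕ} {E : Type*} [MeasurableSpace E]

/-- Tonelli's theorem for products of functions of single coordinates. -/
theorem lintegral_pi_prod {μ : Fin n → Measure E} [∀ i, SigmaFinite (μ i)]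
    {f : Fin n → E → ℝ≥0∞} (hf : ∀ i, Measurable (f i)) :
    ∫⁻ x, ∏ i, f i (x i) ∂(Measure.pi μ) = ∏ i, ∫⁻ x, f i x ∂(μ i) := by
  induction n with
  | zero => simp
  | succ n ih =>
    rw [← ((measurePreserving_piFinSuccAbove μ 0).symm).lintegral_comp_emb
      (MeasurableEquiv.measurableEmbedding _)]
    simp_rw [MeasurableEquiv.piFinSuccAbove_symm_apply, Fin.insertNthEquiv,
      Fin.prod_univ_succ, Fin.insertNth_zero, Equiv.coe_fn_mk, Fin.cons_succ,
      Fin.zero_succAbove, cast_eq, Fin.cons_zero]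
    have hm : Measurable fun x : Fin n → E => ∏ i, f (Fin.succ i) (x i) :=
      Finset.measurable_prod _ fun i _ => (hf (Fin.succ i)).comp (measurable_pi_apply i)
    rw [lintegral_prod_mul (hf 0).aemeasurable hm.aemeasurable, ih fun i => hf i.succ]

/-- A product of measures with densities has the product density. -/
theorem pi_withDensity {μ : Fin n → Measure E} [∀ i, SigmaFinite (μ i)]
    {f : Fin n → E → ℝ≥0∞} (hf : ∀ i, Measurable (f i)) (hf' : ∀ i x, f i x ≠ ∞) :
    Measure.pi (fun i => (μ i).withDensity (f i)) =
      (Measure.pi μ).withDensity fun x => ∏ i, f i (x i) := by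
  have : ∀ i, SigmaFinite ((μ i).withDensity (f i)) := fun i =>
    SigmaFinite.withDensity_of_ne_top (ae_of_all _ (hf' i))
  refine Measure.pi_eq fun s hs => ?_
  rw [withDensity_apply _ (MeasurableSet.univ_pi hs), ← lintegral_indicator
    (MeasurableSet.univ_pi hs)]
  have h : ∀ x : Fin n → E, (Set.univ.pi s).indicator (fun x => ∏ i, f i (x i)) x =
      ∏ i, (s i).indicator (f i) (x i) := by
    intro x
    by_cases hx : x ∈ Set.univ.pi s
    · rw [Set.indicator_of_mem hx]
      exact Finset.prod_congr rfl fun i _ => (Set.indicator_of_mem (hx i trivial) _).symm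
    · rw [Set.indicator_of_notMem hx]
      simp only [Set.mem_pi, Set.mem_univ, true_implies, not_forall] at hx
      obtain ⟨i, hi⟩ := hx
      exact (Finset.prod_eq_zero (Finset.mem_univ i) (Set.indicator_of_notMem hi _)).symm
  simp_rw [h]
  rw [lintegral_pi_prod fun i => (hf i).indicator (hs i)]
  exact Finset.prod_congr rfl fun i _ => by
    rw [lintegral_indicator (hs i), withDensity_apply _ (hs i)]

end Products

/-! ### Densities and moments of complex Gaussians. -/

section ComplexGaussian

/-- The Lebesgue density of `CN(0, v)`. -/
def complexGaussianPDF (v : ℝ≥0) (z : ℂ) : ℝ≥0∞ :=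
  ENNReal.ofReal ((Real.pi * v)⁻¹ * Real.exp (-(‖z‖ ^ 2 / v)))

theorem measurable_complexGaussianPDF (v : ℝ≥0) : Measurable (complexGaussianPDF v) := by
  unfold complexGaussianPDF; fun_prop

theorem complexGaussianPDF_ne_top (v : ℝ≥0) (z : ℂ) : complexGaussianPDF v z ≠ ∞ :=
  ENNReal.ofReal_ne_top

theorem complexGaussian_eq_withDensity {v : ℝ≥0} (hv : v ≠ 0) :
    complexGaussian v = volume.withDensity (complexGaussianPDF v) := by
  have hv2 : v / 2 ≠ 0 := by simpa using hv
  have hv' : (0 : ℝ) < v := by positivity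
  rw [complexGaussian, gaussianReal_of_var_ne_zero _ hv2,
    prod_withDensity (measurable_gaussianPDF _ _) (measurable_gaussianPDF _ _)]
  have h := Complex.volume_preserving_equiv_real_prod.symm
  have he : (fun p : ℝ × ℝ => (⟨p.1, p.2⟩ : ℂ)) = Complex.measurableEquivRealProd.symm := rfl
  ext s hs
  rw [he, Measure.map_apply (MeasurableEquiv.measurable _) hs,
    withDensity_apply _ (MeasurableEquiv.measurable _ hs), withDensity_apply _ hs,
    ← h.setLIntegral_comp_preimage hs (measurable_complexGaussianPDF v)]
  refine setLIntegral_congr_fun (MeasurableEquiv.measurable _ hs) fun p _ => ?_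
  have hn : ‖Complex.measurableEquivRealProd.symm p‖ ^ 2 = p.1 ^ 2 + p.2 ^ 2 := by
    rw [← he, Complex.sq_norm, Complex.normSq_mk]; ring
  simp only [complexGaussianPDF, gaussianPDF, gaussianPDFReal, hn]
  rw [← ENNReal.ofReal_mul (by positivity)]
  congr 1
  have h2 : √(2 * Real.pi * ((v / 2 : ℝ≥0) : ℝ)) * √(2 * Real.pi * ((v / 2 : ℝ≥0) : ℝ)) =
      Real.pi * v := by
    rw [Real.mul_self_sqrt (by positivity)]; push_cast; ring
  rw [mul_mul_mul_comm, ← mul_inv, h2, ← Real.exp_add]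
  congr 2
  push_cast
  field_simp
  ring

instance (v : ℝ≥0) : IsProbabilityMeasure (complexGaussian v) := by
  unfold complexGaussian
  refine Measure.isProbabilityMeasure_map ?_
  exact Complex.measurableEquivRealProd.symm.measurable.aemeasurable

theorem lintegral_sq_gaussianReal (v : ℝ≥0) :
    ∫⁻ x, ‖x‖ₑ ^ 2 ∂(gaussianReal 0 v) = v := by
  have h := variance_fun_id_gaussianReal (μ := 0) (v := v)
  have hm : MemLp (fun x : ℝ => x) 2 (gaussianReal 0 v) := memLp_id_gaussianReal 2
  have h2 := hm.ofReal_variance_eq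
  rw [h, evariance] at h2
  simp only [integral_id_gaussianReal, sub_zero, ENNReal.ofReal_coe_nnreal] at h2
  exact h2.symm

theorem lintegral_sq_complexGaussian (v : ℝ≥0) :
    ∫⁻ z, ‖z‖ₑ ^ 2 ∂(complexGaussian v) = v := by
  have hm : Measurable fun p : ℝ × ℝ => (⟨p.1, p.2⟩ : ℂ) :=
    Complex.measurableEquivRealProd.symm.measurable
  rw [complexGaussian, lintegral_map (by fun_prop) hm]
  have h : ∀ p : ℝ × ℝ, ‖(⟨p.1, p.2⟩ : ℂ)‖ₑ ^ 2 = ‖p.1‖ₑ ^ 2 + ‖p.2‖ₑ ^ 2 := by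
    intro p
    rw [← ofReal_norm, ← ofReal_norm, ← ofReal_norm, ← ENNReal.ofReal_pow (norm_nonneg _),
      ← ENNReal.ofReal_pow (norm_nonneg _), ← ENNReal.ofReal_pow (norm_nonneg _),
      ← ENNReal.ofReal_add (by positivity) (by positivity), Complex.sq_norm, Complex.normSq_mk,
      Real.norm_eq_abs, Real.norm_eq_abs, sq_abs, sq_abs]
    congr 1; ring
  simp_rw [h]
  rw [lintegral_add_left (by fun_prop), lintegral_prod _ (by fun_prop),
    lintegral_prod _ (by fun_prop)]
  simp [lintegral_sq_gaussianReal]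

theorem lintegral_exp_neg_mul_sq (b : ℝ) (hb : 0 < b) (z₀ : ℂ) :
    ∫⁻ z : ℂ, ENNReal.ofReal (Real.exp (-b * ‖z - z₀‖ ^ 2)) = ENNReal.ofReal (Real.pi / b) := by
  rw [lintegral_sub_right_eq_self (fun z : ℂ => ENNReal.ofReal (Real.exp (-b * ‖z‖ ^ 2))) z₀]
  have h := GaussianFourier.integral_rexp_neg_mul_sq_norm (V := ℂ) hb
  have hi : Integrable fun z : ℂ => Real.exp (-b * ‖z‖ ^ 2) := by
    by_contra hc
    rw [integral_undef hc] at h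
    have : 0 < (Real.pi / b) ^ (Module.finrank ℝ ℂ / 2 : ℝ) := by positivity
    linarith
  rw [← ofReal_integral_eq_lintegral_ofReal hi (ae_of_all _ fun z => (Real.exp_pos _).le), h]
  simp

theorem complexGaussianPDF_one_le (z : ℂ) : complexGaussianPDF 1 z ≤ 1 := by
  unfold complexGaussianPDF
  rw [ENNReal.ofReal_le_one]
  have h1 : Real.exp (-(‖z‖ ^ 2 / ((1 : ℝ≥0) : ℝ))) ≤ 1 := by
    rw [Real.exp_le_one_iff]; simp
  have h2 : (Real.pi * ((1 : ℝ≥0) : ℝ))⁻¹ ≤ 1 := by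
    rw [inv_le_one_iff₀]; right; simp; linarith [Real.pi_gt_three]
  exact mul_le_one₀ h2 (Real.exp_pos _).le h1

theorem lintegral_complexGaussianPDF_sub (a : ℂ) :
    ∫⁻ z, complexGaussianPDF 1 (z - a) = 1 := by
  rw [lintegral_sub_right_eq_self (complexGaussianPDF 1) a]
  have := measure_univ (μ := complexGaussian 1)
  rwa [complexGaussian_eq_withDensity one_ne_zero, withDensity_apply _ .univ,
    Measure.restrict_univ] at this

/-- The density at `y` of `g x + w` with independent `g ∼ CN(0, s)`, `w ∼ CN(0, 1)`. -/
theorem lintegral_complexGaussianPDF_sub_mul_le {s : ℝ≥0} (hs : s ≠ 0) (x y : ℂ) :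
    ∫⁻ g, complexGaussianPDF 1 (y - g * x) ∂(complexGaussian s) ≤
      ENNReal.ofReal ((1 + s * ‖x‖ ^ 2)⁻¹) := by
  have hs' : (0 : ℝ) < s := by positivity
  -- Completing the square in `g`: `A` is the posterior precision of the gain given `y`, and `g₀`
  -- its posterior mean. The remaining term in `y` is nonnegative and is dropped.
  set A : ℝ := (s : ℝ)⁻¹ + ‖x‖ ^ 2 with hA
  have hA0 : 0 < A := by positivity
  set g₀ : ℂ := (starRingEnd ℂ x) * y / A with hg₀
  have hq : ∀ g : ℂ, A * ‖g - g₀‖ ^ 2 ≤ ‖g‖ ^ 2 / s + ‖y - g * x‖ ^ 2 := by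
    intro g
    have e1 : A * ‖g - g₀‖ ^ 2 = A * ‖g‖ ^ 2 - 2 * (g * x * starRingEnd ℂ y).re
        + ‖x‖ ^ 2 * ‖y‖ ^ 2 / A := by
      have hA' := hA0.ne'
      rw [Complex.sq_norm, Complex.sq_norm, Complex.sq_norm, Complex.sq_norm, Complex.normSq_sub,
        hg₀, Complex.normSq_div, Complex.normSq_mul, Complex.normSq_conj, Complex.normSq_ofReal]
      have : (g * starRingEnd ℂ ((starRingEnd ℂ x) * y / A)).re =
          (g * x * starRingEnd ℂ y).re / A := by
        rw [map_div₀, map_mul, Complex.conj_conj, Complex.conj_ofReal, ← mul_div_assoc,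
          Complex.div_ofReal_re, mul_assoc]
      rw [this]
      field_simp
      ring
    have e2 : ‖y - g * x‖ ^ 2 = ‖y‖ ^ 2 + ‖g‖ ^ 2 * ‖x‖ ^ 2
        - 2 * (g * x * starRingEnd ℂ y).re := by
      rw [norm_sub_rev, Complex.sq_norm, Complex.sq_norm, Complex.sq_norm, Complex.sq_norm,
        Complex.normSq_sub, Complex.normSq_mul]
      ring
    have e3 : ‖x‖ ^ 2 * ‖y‖ ^ 2 / A ≤ ‖y‖ ^ 2 := by
      rw [div_le_iff₀ hA0, hA]
      have : 0 ≤ ‖y‖ ^ 2 * (s : ℝ)⁻¹ := by positivity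
      nlinarith
    have e4 : A * ‖g‖ ^ 2 = ‖g‖ ^ 2 / s + ‖g‖ ^ 2 * ‖x‖ ^ 2 := by rw [hA]; ring
    rw [e1, e2, e4]
    linarith
  rw [complexGaussian_eq_withDensity hs, lintegral_withDensity_eq_lintegral_mul _
    (measurable_complexGaussianPDF s)
    (show Measurable fun g : ℂ => complexGaussianPDF 1 (y - g * x) from
      (measurable_complexGaussianPDF 1).comp (by fun_prop))]
  calc _ ≤ ∫⁻ g, ENNReal.ofReal ((Real.pi * s)⁻¹ * 1) *
        ENNReal.ofReal (Real.exp (-A * ‖g - g₀‖ ^ 2)) := by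
        refine lintegral_mono fun g => ?_
        simp only [Pi.mul_apply, complexGaussianPDF]
        rw [← ENNReal.ofReal_mul (by positivity), ← ENNReal.ofReal_mul (by positivity)]
        refine ENNReal.ofReal_le_ofReal ?_
        have h1 : (Real.pi * ((1 : ℝ≥0) : ℝ))⁻¹ ≤ 1 := by
          rw [inv_le_one_iff₀]; right; simp; linarith [Real.pi_gt_three]
        rw [mul_mul_mul_comm, ← Real.exp_add]
        gcongr
        have := hq g
        simp only [NNReal.coe_one, div_one]
        linarith
    _ = ENNReal.ofReal ((1 + s * ‖x‖ ^ 2)⁻¹) := by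
        rw [lintegral_const_mul _ (by fun_prop), lintegral_exp_neg_mul_sq A hA0,
          ← ENNReal.ofReal_mul (by positivity)]
        congr 1
        rw [hA]
        field_simp

end ComplexGaussian

/-- Heavy-tailed sub-probability densities on a finite-dimensional space. -/
theorem exists_lintegral_exp_neg_le_one (E : Type*) [NormedAddCommGroup E] [NormedSpace ℝ E]
    [FiniteDimensional ℝ E] [MeasureSpace E] [BorelSpace E]
    [(volume : Measure E).IsAddHaarMeasure] {r : ℝ} (hr : (Module.finrank ℝ E : ℝ) < 2 * r) :
    ∃ A : ℝ, 0 ≤ A ∧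
      ∫⁻ y : E, ENNReal.ofReal (Real.exp (-(A + r * Real.log (1 + ‖y‖ ^ 2)))) ≤ 1 := by
  have hi := integrable_rpow_neg_one_add_norm_sq (μ := (volume : Measure E)) hr
  set C := ∫⁻ y : E, ENNReal.ofReal ((1 + ‖y‖ ^ 2) ^ (-(2 * r) / 2)) with hC
  have hC' : C < ∞ := hi.lintegral_lt_top
  -- Normalizing by `1 + C` rather than `C` keeps `A` nonnegative.
  refine ⟨Real.log (1 + C.toReal), Real.log_nonneg (by simp), ?_⟩
  have h : ∀ y : E, ENNReal.ofReal (Real.exp (-(Real.log (1 + C.toReal) +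
      r * Real.log (1 + ‖y‖ ^ 2)))) =
      ENNReal.ofReal ((1 + C.toReal)⁻¹) * ENNReal.ofReal ((1 + ‖y‖ ^ 2) ^ (-(2 * r) / 2)) := by
    intro y
    rw [← ENNReal.ofReal_mul (by positivity), neg_add, Real.exp_add, ← Real.log_inv,
      Real.exp_log (by positivity), Real.rpow_def_of_pos (by positivity)]
    congr 3
    ring
  simp_rw [h]
  rw [lintegral_const_mul' _ _ ENNReal.ofReal_ne_top, ← hC, ← ENNReal.ofReal_toReal hC'.ne,
    ← ENNReal.ofReal_mul (by positivity), ENNReal.ofReal_le_one, ENNReal.toReal_ofReal (by simp),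
    inv_mul_le_iff₀ (by positivity)]
  linarith

/-! ### From inequalities on correct decoding to bounds on rates and gDoF. -/

section

instance (γ : LinkExponents) (snr : ℝ) (n : ℕ) : IsProbabilityMeasure (fadingLaw γ snr n) := by
  unfold fadingLaw; infer_instance

instance (n T : ℕ) : IsProbabilityMeasure (noiseLaw n T) := by
  unfold noiseLaw; infer_instance

instance (γ : LinkExponents) (snr : ℝ) (n T : ℕ) :
    IsProbabilityMeasure (channelLaw γ snr n T) := by
  unfold channelLaw; infer_instance

namespace Code

variable {n T M : ℕ}

theorem measurable_relayInput (c : Code n T M) (m : Fin M) (i : Fin 2) :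
    Measurable fun ω => c.relayInput m ω i := by
  have h : Measurable fun ω : Fading n × Noise n T => c.source ω.1 m :=
    (c.measurable_source m).comp measurable_fst
  unfold relayInput
  refine measurable_pi_lambda _ fun b => measurable_pi_lambda _ fun t => ?_
  have h2 : Measurable fun ω : Fading n × Noise n T => c.source ω.1 m b t :=
    measurable_pi_iff.1 (measurable_pi_iff.1 h b) t
  fun_prop

theorem measurable_relayOutput (c : Code n T M) (m : Fin M) (i : Fin 2) :
    Measurable fun ω => c.relayOutput m ω i :=
  (c.measurable_relay i).comp (measurable_fst.prodMk (c.measurable_relayInput m i))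

theorem measurable_destInput (c : Code n T M) (m : Fin M) :
    Measurable fun ω => c.destInput m ω := by
  unfold destInput
  refine measurable_pi_lambda _ fun b => measurable_pi_lambda _ fun t => ?_
  have h2 : ∀ i, Measurable fun ω : Fading n × Noise n T => c.relayOutput m ω i b t := fun i =>
    measurable_pi_iff.1 (measurable_pi_iff.1 (c.measurable_relayOutput m i) b) t
  fun_prop

/-- The event that message `m` is decoded correctly when it is sent. -/
def correct (c : Code n T M) (m : Fin M) : Set (Fading n × Noise n T) :=
  {ω | c.decode ω.1 (c.destInput m ω) = m}

theorem measurableSet_correct (c : Code n T M) (m : Fin M) : MeasurableSet (c.correct m) :=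
  (c.measurable_decode.comp (measurable_fst.prodMk (c.measurable_destInput m)))
    (measurableSet_singleton m)

theorem le_sum_correct (c : Code n T M) (γ : LinkExponents) (snr : ℝ) {ε : ℝ} (hε : 0 ≤ ε)
    (h : c.errorProb γ snr ≤ ENNReal.ofReal ε) :
    (M : ℝ) * (1 - ε) ≤ ∑ m, (channelLaw γ snr n T).real (c.correct m) := by
  rcases Nat.eq_zero_or_pos M with rfl | hM
  · simp
  have hM' : (M : ℝ≥0∞) ≠ 0 := by exact_mod_cast hM.ne'
  unfold errorProb at h
  rw [ENNReal.div_le_iff hM' (ENNReal.natCast_ne_top M)] at h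
  have hc : ∀ m, (channelLaw γ snr n T) {ω | c.decode ω.1 (c.destInput m ω) ≠ m} =
      ENNReal.ofReal (1 - (channelLaw γ snr n T).real (c.correct m)) := by
    intro m
    rw [← probReal_compl_eq_one_sub (c.measurableSet_correct m), ofReal_measureReal]
    rfl
  simp_rw [hc] at h
  rw [← ENNReal.ofReal_sum_of_nonneg, ← ENNReal.ofReal_natCast, ← ENNReal.ofReal_mul hε,
    ENNReal.ofReal_le_ofReal_iff (by positivity)] at h
  · rw [Finset.sum_sub_distrib] at h
    simp only [Finset.sum_const, Finset.card_univ, Fintype.card_fin, nsmul_eq_mul, mul_one] at h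
    linarith
  · intro m _
    linarith [measureReal_le_one (μ := channelLaw γ snr n T) (s := c.correct m)]

end Code

/-- A code class obeys a converse bound with `d` degrees of freedom per block. -/
def ConverseBound (T : ℕ) (γ : LinkExponents) (K : ∀ n M : ℕ, Code n T M → Prop) (d : ℝ) : Prop :=
  ∀ d' > d, ∃ C : ℝ, 0 ≤ C ∧ ∀ᶠ snr : ℝ in atTop, ∀ (n M : ℕ) (c : Code n T M), K n M c →
    c.PowerConstraint γ snr → ∀ L : ℝ, 0 < L →
      L * ∑ m, (channelLaw γ snr n T).real (c.correct m) ≤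
        L * Real.exp L + M * n * (d' * Real.log snr + C)

variable {T : ℕ} {γ : LinkExponents} {K K' : ∀ n M : ℕ, Code n T M → Prop} {d d₁ : ℝ}

theorem ConverseBound.or (h : ConverseBound T γ K d) (h' : ConverseBound T γ K' d) :
    ConverseBound T γ (fun n M c => K n M c ∨ K' n M c) d := by
  intro d' hd
  obtain ⟨C, hC, h⟩ := h d' hd
  obtain ⟨C', hC', h'⟩ := h' d' hd
  refine ⟨max C C', le_max_of_le_left hC, ?_⟩
  filter_upwards [h, h'] with snr h h' n M c hc hp L hL
  have h1 : (M : ℝ) * n * (d' * Real.log snr + C) ≤ M * n * (d' * Real.log snr + max C C') := by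
    gcongr; exact le_max_left _ _
  have h2 : (M : ℝ) * n * (d' * Real.log snr + C') ≤ M * n * (d' * Real.log snr + max C C') := by
    gcongr; exact le_max_right _ _
  rcases hc with hc | hc
  · linarith [h n M c hc hp L hL]
  · linarith [h' n M c hc hp L hL]

theorem ConverseBound.mono (h : ConverseBound T γ K d)
    (hK : ∀ n M (c : Code n T M), K' n M c → K n M c) (hd : d ≤ d₁) :
    ConverseBound T γ K' d₁ := by
  intro d' hd'
  obtain ⟨C, hC, h⟩ := h d' (hd.trans_lt hd')
  exact ⟨C, hC, h.mono fun snr h n M c hc => h n M c (hK n M c hc)⟩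

/-- With `L = n β`, the average probability of success is at most `exp (n β) / M + B / β`. If the
rate in nats per block exceeds `β > B`, the first term vanishes as `n` grows and the second stays
below one, so the error probability cannot tend to zero. -/
theorem Achievable.rate_le {snr B : ℝ} (hB : 0 ≤ B)
    (h : ∀ (n M : ℕ) (c : Code n T M), K n M c → c.PowerConstraint γ snr → ∀ L : ℝ, 0 < L →
      L * ∑ m, (channelLaw γ snr n T).real (c.correct m) ≤ L * Real.exp L + M * n * B)
    {R : ℝ≥0} (hR : Achievable T γ K snr R) : (T : ℝ) * R * Real.log 2 ≤ B := by
  by_contra! hlt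
  set ρ : ℝ := (T : ℝ) * R * Real.log 2 with hρ
  obtain ⟨β, hβ1, hβ2⟩ := exists_between hlt
  have hβ : 0 < β := hB.trans_lt hβ1
  set ε : ℝ := (1 - B / β) / 2 with hε
  have hε0 : 0 < ε := by
    have : B / β < 1 := (div_lt_one hβ).2 hβ1
    rw [hε]; linarith
  have hβε : β * (1 - ε) - B = (β - B) / 2 := by rw [hε]; field_simp; ring
  have hlim : Tendsto (fun n : ℕ => β * Real.exp (-((n : ℝ) * (ρ - β)))) atTop (𝓝 0) := by
    have h1 : Tendsto (fun n : ℕ => (n : ℝ) * (ρ - β)) atTop atTop :=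
      tendsto_natCast_atTop_atTop.atTop_mul_const (by linarith)
    simpa using (Real.tendsto_exp_neg_atTop_nhds_zero.comp h1).const_mul β
  have hev := hlim.eventually_lt_const (show (0 : ℝ) < (β - B) / 2 by linarith)
  obtain ⟨n, ⟨hn1, hn0⟩, M, c, hM, hK, hp, he⟩ :=
    ((hev.and (eventually_gt_atTop 0)).and (hR (ENNReal.ofReal ε) (by simpa using hε0))).exists
  have hn : (0 : ℝ) < n := by exact_mod_cast hn0
  have hM' : Real.exp (n * ρ) ≤ M := by
    refine le_trans (le_of_eq ?_) hM
    rw [Real.rpow_def_of_pos two_pos, hρ]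
    congr 1; ring
  have hM0 : (0 : ℝ) < M := (Real.exp_pos _).trans_le hM'
  have h1 := h n M c hK hp (n * β) (by positivity)
  have h2 := c.le_sum_correct γ snr hε0.le he
  have h3 : (n : ℝ) * β * (M * (1 - ε)) ≤ n * β * Real.exp (n * β) + M * n * B :=
    (mul_le_mul_of_nonneg_left h2 (by positivity)).trans h1
  have h4 : (n : ℝ) * M * ((β - B) / 2) ≤ n * (β * Real.exp (n * β)) := by
    rw [← hβε]; linarith
  have h5 : (M : ℝ) * ((β - B) / 2) ≤ β * Real.exp (n * β) := by
    rw [mul_assoc] at h4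
    exact le_of_mul_le_mul_left h4 hn
  have h6 : Real.exp (n * β) = Real.exp (-(n * (ρ - β))) * Real.exp (n * ρ) := by
    rw [← Real.exp_add]; congr 1; ring
  have h7 : β * Real.exp (n * β) ≤ β * Real.exp (-(n * (ρ - β))) * M := by
    rw [h6, ← mul_assoc]; gcongr
  have h8 : (M : ℝ) * (β * Real.exp (-(n * (ρ - β)))) < M * ((β - B) / 2) := by gcongr
  linarith

theorem ConverseBound.mul_gDoF_le (hT : 0 < T) (hd : 0 ≤ d) (h : ConverseBound T γ K d) :
    (T : ℝ≥0∞) * gDoF T γ K ≤ ENNReal.ofReal d := by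
  refine ENNReal.le_of_forall_pos_le_add fun ε hε _ => ?_
  have hT' : (0 : ℝ) < T := by exact_mod_cast hT
  have hε' : (0 : ℝ) < ε := hε
  have hg : gDoF T γ K ≤ ENNReal.ofReal ((d + ε) / T) := by
    -- One half of `ε` is the slack in the exponent; the other half absorbs `C` once `log snr` is
    -- large.
    obtain ⟨C, hC, h⟩ := h (d + ε / 2) (by linarith)
    refine limsup_le_of_le (by isBoundedDefault) ?_
    have hlog : ∀ᶠ snr : ℝ in atTop, 2 * C / ε + 1 ≤ Real.log snr :=
      Real.tendsto_log_atTop.eventually_ge_atTop _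
    filter_upwards [h, hlog] with snr h hlog
    have hl : 0 < Real.log snr := by
      have : 0 ≤ 2 * C / ε := by positivity
      linarith
    have hC2 : C ≤ ε / 2 * Real.log snr := by
      have h1 : 2 * C / ε ≤ Real.log snr := by linarith
      rw [div_le_iff₀ hε'] at h1
      linarith
    have hl2 : 0 < Real.log 2 := Real.log_pos one_lt_two
    have hlb : 0 < Real.logb 2 snr := div_pos hl hl2
    rw [ENNReal.div_le_iff (by simpa using hlb) ENNReal.ofReal_ne_top,
      ← ENNReal.ofReal_mul (by positivity)]
    refine iSup₂_le fun R hR => ?_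
    have hrate := Achievable.rate_le (by positivity) h hR
    rw [← ENNReal.ofReal_coe_nnreal]
    refine ENNReal.ofReal_le_ofReal ?_
    rw [Real.logb, div_mul_div_comm, le_div_iff₀ (by positivity)]
    linarith
  calc (T : ℝ≥0∞) * gDoF T γ K ≤ T * ENNReal.ofReal ((d + ε) / T) := by gcongr
    _ = ENNReal.ofReal (d + ε) := by
      rw [← ENNReal.ofReal_natCast, ← ENNReal.ofReal_mul hT'.le, mul_div_cancel₀ _ hT'.ne']
    _ = ENNReal.ofReal d + ε := by
      rw [ENNReal.ofReal_add hd hε'.le, ENNReal.ofReal_coe_nnreal]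

/-- Change of measure: if the correct decisions with small likelihood exponent `ℓ m` have total
probability at most `exp L`, then Markov's inequality bounds the total probability of a correct
decision. -/
theorem mul_sum_measureReal_le {Ω : Type*} [MeasurableSpace Ω] (P : Measure Ω)
    [IsProbabilityMeasure P] {M : ℕ} {E : Fin M → Set Ω} {ℓ : Fin M → Ω → ℝ}
    (hℓ : ∀ m, Measurable (ℓ m)) {L : ℝ} (hL : 0 < L) {D : ℝ} (hD : 0 ≤ D)
    (h1 : ∑ m, P (E m ∩ {ω | ℓ m ω ≤ L}) ≤ ENNReal.ofReal (Real.exp L))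
    (h2 : ∑ m, ∫⁻ ω, ENNReal.ofReal (ℓ m ω) ∂P ≤ ENNReal.ofReal D) :
    L * ∑ m, P.real (E m) ≤ L * Real.exp L + D := by
  have h3 : ∀ m, ENNReal.ofReal L * P (E m) ≤
      ENNReal.ofReal L * P (E m ∩ {ω | ℓ m ω ≤ L}) + ∫⁻ ω, ENNReal.ofReal (ℓ m ω) ∂P := by
    intro m
    have hM : ENNReal.ofReal L * P {ω | L < ℓ m ω} ≤ ∫⁻ ω, ENNReal.ofReal (ℓ m ω) ∂P := by
      refine le_trans ?_ (mul_meas_ge_le_lintegral (hℓ m).ennreal_ofReal (ENNReal.ofReal L))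
      gcongr with ω
      intro hω
      exact ENNReal.ofReal_le_ofReal (le_of_lt hω)
    calc ENNReal.ofReal L * P (E m)
        ≤ ENNReal.ofReal L * (P (E m ∩ {ω | ℓ m ω ≤ L}) + P {ω | L < ℓ m ω}) := by
          gcongr
          refine (measure_mono fun ω hω => ?_).trans (measure_union_le _ _)
          rcases le_or_gt (ℓ m ω) L with h | h
          · exact Or.inl ⟨hω, h⟩
          · exact Or.inr h
      _ ≤ _ := by rw [mul_add]; gcongr
  have h4 : ENNReal.ofReal (L * ∑ m, P.real (E m)) ≤
      ENNReal.ofReal (L * Real.exp L + D) := by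
    rw [ENNReal.ofReal_mul hL.le, ENNReal.ofReal_sum_of_nonneg fun _ _ => measureReal_nonneg,
      ENNReal.ofReal_add (by positivity) hD, ENNReal.ofReal_mul hL.le, Finset.mul_sum]
    have h5 : ∀ m, ENNReal.ofReal (P.real (E m)) = P (E m) := fun m => ofReal_measureReal
    simp_rw [h5]
    refine (Finset.sum_le_sum fun m _ => h3 m).trans ?_
    rw [Finset.sum_add_distrib, ← Finset.mul_sum]
    gcongr
  exact (ENNReal.ofReal_le_ofReal_iff (by positivity)).1 h4

end

/-! ### Change of measure, reference densities and moment estimates. -/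

section

section ChangeOfMeasure

/-- Events dominated by a fixed sub-probability measure on disjoint sets. -/
theorem sum_measure_le_of_dominated {Ω Y : Type*} [MeasurableSpace Ω] [MeasurableSpace Y]
    {P : Measure Ω} {Q : Measure Y} (hQ : Q Set.univ ≤ 1) {M : ℕ} {E : Fin M → Set Ω}
    {dec : Y → Fin M} (hdec : Measurable dec) {c : ℝ≥0∞}
    (h : ∀ m, P (E m) ≤ c * Q (dec ⁻¹' {m})) : ∑ m, P (E m) ≤ c := by
  calc ∑ m, P (E m) ≤ ∑ m, c * Q (dec ⁻¹' {m}) := Finset.sum_le_sum fun m _ => h m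
    _ = c * ∑ m, Q (dec ⁻¹' {m}) := by rw [Finset.mul_sum]
    _ ≤ c * Q Set.univ := by
        gcongr
        refine sum_measure_le_measure_univ
          (fun m _ => (hdec (measurableSet_singleton m)).nullMeasurableSet) fun i _ j _ hij => ?_
        refine Disjoint.aedisjoint ?_
        rw [Set.disjoint_left]
        rintro y rfl hy
        exact hij hy
    _ ≤ c := mul_le_of_le_one_right' hQ

/-- Conditioning: the bound may be proved with `θ` frozen, so the decoder and the reference measure
are both allowed to depend on `θ`. This is how perfect channel knowledge is accommodated. -/
theorem sum_prod_le {Θ Ω : Type*} [MeasurableSpace Θ] [MeasurableSpace Ω] {ν : Measure Θ}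
    {P : Measure Ω} [IsProbabilityMeasure ν] [SFinite P] {M : ℕ} {E : Fin M → Set (Θ × Ω)}
    (hE : ∀ m, MeasurableSet (E m)) {c : ℝ≥0∞}
    (h : ∀ θ, ∑ m, P (Prod.mk θ ⁻¹' E m) ≤ c) : ∑ m, (ν.prod P) (E m) ≤ c := by
  simp_rw [fun m => Measure.prod_apply (μ := ν) (ν := P) (hE m)]
  rw [← lintegral_finsetSum _ fun m _ => measurable_measure_prodMk_left (hE m)]
  calc _ ≤ ∫⁻ _, c ∂ν := lintegral_mono h
    _ = c := by simp

theorem sum_prod_le_symm {Θ Ω : Type*} [MeasurableSpace Θ] [MeasurableSpace Ω] {ν : Measure Θ}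
    {P : Measure Ω} [IsProbabilityMeasure ν] [SFinite P] {M : ℕ} {E : Fin M → Set (Ω × Θ)}
    (hE : ∀ m, MeasurableSet (E m)) {c : ℝ≥0∞}
    (h : ∀ θ, ∑ m, P ((fun x => (x, θ)) ⁻¹' E m) ≤ c) : ∑ m, (P.prod ν) (E m) ≤ c := by
  simp_rw [fun m => Measure.prod_apply_symm (μ := P) (ν := ν) (hE m)]
  rw [← lintegral_finsetSum _ fun m _ => measurable_measure_prodMk_right (hE m)]
  calc _ ≤ ∫⁻ _, c ∂ν := lintegral_mono h
    _ = c := by simp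

theorem withDensity_inter_le {Y : Type*} [MeasurableSpace Y] {μ : Measure Y}
    {k r : Y → ℝ≥0∞} {ℓ : Y → ℝ} (hℓ : Measurable ℓ)
    (h : ∀ y, k y ≤ ENNReal.ofReal (Real.exp (ℓ y)) * r y) {A : Set Y} (hA : MeasurableSet A)
    (L : ℝ) :
    ∫⁻ y in A ∩ {y | ℓ y ≤ L}, k y ∂μ ≤
      ENNReal.ofReal (Real.exp L) * μ.withDensity r A := by
  have hs : MeasurableSet (A ∩ {y | ℓ y ≤ L}) := hA.inter (measurableSet_le hℓ measurable_const)
  rw [withDensity_apply _ hA, ← lintegral_const_mul' _ _ ENNReal.ofReal_ne_top]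
  calc ∫⁻ y in A ∩ {y | ℓ y ≤ L}, k y ∂μ
      ≤ ∫⁻ y in A ∩ {y | ℓ y ≤ L}, ENNReal.ofReal (Real.exp L) * r y ∂μ := by
        refine setLIntegral_mono' hs fun y hy => (h y).trans ?_
        gcongr
        exact hy.2
    _ ≤ _ := lintegral_mono_set Set.inter_subset_left

end ChangeOfMeasure

variable {n T M : ℕ}

/-- The law of the additive noise at one node. -/
abbrev signalNoise (n T : ℕ) : Measure (Signal n T) :=
  Measure.pi fun _ => Measure.pi fun _ => complexGaussian 1

theorem signalNoise_eq_withDensity :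
    signalNoise n T = volume.withDensity fun w => ∏ b, ∏ t, complexGaussianPDF 1 (w b t) := by
  have h1 : (Measure.pi fun _ : Fin T => complexGaussian 1) =
      volume.withDensity fun w : Fin T → ℂ => ∏ t, complexGaussianPDF 1 (w t) := by
    simp_rw [complexGaussian_eq_withDensity one_ne_zero]
    exact pi_withDensity (fun _ => measurable_complexGaussianPDF 1)
      fun _ => complexGaussianPDF_ne_top 1
  unfold signalNoise
  rw [h1]
  refine pi_withDensity (μ := fun _ => volume) (fun _ => ?_) fun _ w => ?_
  · exact Finset.measurable_prod _ fun t _ =>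
      (measurable_complexGaussianPDF 1).comp (measurable_pi_apply t)
  · exact ENNReal.prod_ne_top fun t _ => complexGaussianPDF_ne_top 1 _

theorem signalNoise_add_mem (a : Signal n T) {A : Set (Signal n T)} (hA : MeasurableSet A) :
    signalNoise n T {w | a + w ∈ A} =
      ∫⁻ y in A, ∏ b, ∏ t, complexGaussianPDF 1 (y b t - a b t) := by
  have hA' : MeasurableSet {w : Signal n T | a + w ∈ A} := (measurable_const_add a) hA
  rw [signalNoise_eq_withDensity, withDensity_apply _ hA', ← lintegral_indicator hA',
    ← lintegral_indicator hA, ← lintegral_add_left_eq_self (A.indicator _) a]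
  refine lintegral_congr fun w => ?_
  by_cases hw : a + w ∈ A
  · rw [Set.indicator_of_mem (show w ∈ {w : Signal n T | a + w ∈ A} from hw),
      Set.indicator_of_mem hw]
    simp
  · rw [Set.indicator_of_notMem (show w ∉ {w : Signal n T | a + w ∈ A} from hw),
      Set.indicator_of_notMem hw]

/-- Logarithm of the inverse of a heavy-tailed density. -/
def tailExponent {E : Type*} [Norm E] (A r : ℝ) (y : E) : ℝ := A + r * Real.log (1 + ‖y‖ ^ 2)

theorem measurable_tailExponent {E : Type*} [NormedAddCommGroup E] [MeasurableSpace E]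
    [OpensMeasurableSpace E] (A r : ℝ) : Measurable (tailExponent (E := E) A r) := by
  unfold tailExponent; fun_prop

/-- Total exponent of the symbols at the times in `Fr`. -/
def signalExponent (A r : ℝ) (Fr : Fin n → Finset (Fin T)) (y : Signal n T) : ℝ :=
  ∑ b, ∑ t ∈ Fr b, tailExponent A r (y b t)

theorem measurable_signalExponent (A r : ℝ) (Fr : Fin n → Finset (Fin T)) :
    Measurable (signalExponent A r Fr) :=
  Finset.measurable_sum _ fun b _ => Finset.measurable_sum _ fun t _ =>
    (measurable_tailExponent A r).comp (by fun_prop)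

/-- Reference density for the output of a Gaussian channel: heavy-tailed at the times in `Fr`,
Gaussian with known mean `p` at the other times. -/
def referenceDensity (A r : ℝ) (Fr : Fin n → Finset (Fin T)) (p : Signal n T) (y : Signal n T) :
    ℝ≥0∞ :=
  ∏ b, ∏ t, if t ∈ Fr b then ENNReal.ofReal (Real.exp (-tailExponent A r (y b t)))
    else complexGaussianPDF 1 (y b t - p b t)

theorem lintegral_referenceDensity_le {A r : ℝ}
    (hA : ∫⁻ z : ℂ, ENNReal.ofReal (Real.exp (-tailExponent A r z)) ≤ 1)
    (Fr : Fin n → Finset (Fin T)) (p : Signal n T) :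
    ∫⁻ y, referenceDensity A r Fr p y ≤ 1 := by
  have hm : ∀ b t, Measurable fun z : ℂ =>
      if t ∈ Fr b then ENNReal.ofReal (Real.exp (-tailExponent A r z))
        else complexGaussianPDF 1 (z - p b t) := by
    intro b t
    split_ifs
    · have := measurable_tailExponent (E := ℂ) A r
      fun_prop
    · exact (measurable_complexGaussianPDF 1).comp (by fun_prop)
  have h1 : ∫⁻ y, referenceDensity A r Fr p y = ∏ b, ∏ t, ∫⁻ z : ℂ,
      if t ∈ Fr b then ENNReal.ofReal (Real.exp (-tailExponent A r z))
        else complexGaussianPDF 1 (z - p b t) := by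
    unfold referenceDensity
    refine (lintegral_pi_prod (μ := fun _ : Fin n => (volume : Measure (Fin T → ℂ)))
      (f := fun b y => ∏ t, if t ∈ Fr b then ENNReal.ofReal (Real.exp (-tailExponent A r (y t)))
        else complexGaussianPDF 1 (y t - p b t)) fun b =>
        Finset.measurable_prod _ fun t _ => (hm b t).comp (measurable_pi_apply t)).trans ?_
    exact Finset.prod_congr rfl fun b _ => lintegral_pi_prod fun t => hm b t
  rw [h1]
  refine Finset.prod_le_one' fun b _ => Finset.prod_le_one' fun t _ => ?_
  split_ifs
  · exact hA
  · exact (lintegral_complexGaussianPDF_sub _).le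

/-- At a free time the Gaussian density is at most one, and the exponent cancels the heavy tail
exactly. At any other time both sides carry the same Gaussian factor, so pilots contribute nothing
to the exponent. -/
theorem prod_complexGaussianPDF_le {A r : ℝ} (Fr : Fin n → Finset (Fin T)) {a p : Signal n T}
    (hp : ∀ b, ∀ t ∉ Fr b, a b t = p b t) (y : Signal n T) :
    ∏ b, ∏ t, complexGaussianPDF 1 (y b t - a b t) ≤
      ENNReal.ofReal (Real.exp (signalExponent A r Fr y)) * referenceDensity A r Fr p y := by
  have h1 : ENNReal.ofReal (Real.exp (signalExponent A r Fr y)) =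
      ∏ b, ∏ t, if t ∈ Fr b then ENNReal.ofReal (Real.exp (tailExponent A r (y b t))) else 1 := by
    unfold signalExponent
    rw [Real.exp_sum, ENNReal.ofReal_prod_of_nonneg fun _ _ => (Real.exp_pos _).le]
    refine Finset.prod_congr rfl fun b _ => ?_
    rw [Real.exp_sum, ENNReal.ofReal_prod_of_nonneg fun _ _ => (Real.exp_pos _).le,
      Finset.prod_ite_mem, Finset.univ_inter]
  rw [h1, referenceDensity, ← Finset.prod_mul_distrib]
  refine Finset.prod_le_prod' fun b _ => ?_
  rw [← Finset.prod_mul_distrib]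
  refine Finset.prod_le_prod' fun t _ => ?_
  split_ifs with ht
  · rw [← ENNReal.ofReal_mul (Real.exp_pos _).le, ← Real.exp_add, add_neg_cancel, Real.exp_zero,
      ENNReal.ofReal_one]
    exact complexGaussianPDF_one_le _
  · rw [one_mul, hp b t ht]

theorem signalNoise_inter_le {A r : ℝ} (Fr : Fin n → Finset (Fin T)) {a p : Signal n T}
    (hp : ∀ b, ∀ t ∉ Fr b, a b t = p b t) {D : Set (Signal n T)} (hD : MeasurableSet D) (L : ℝ) :
    signalNoise n T {w | a + w ∈ D ∩ {y | signalExponent A r Fr y ≤ L}} ≤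
      ENNReal.ofReal (Real.exp L) * volume.withDensity (referenceDensity A r Fr p) D := by
  rw [signalNoise_add_mem a (hD.inter (measurableSet_le (measurable_signalExponent A r Fr)
    measurable_const))]
  exact withDensity_inter_le (measurable_signalExponent A r Fr)
    (prod_complexGaussianPDF_le Fr hp) hD L

theorem withDensity_referenceDensity_univ_le {A r : ℝ}
    (hA : ∫⁻ z : ℂ, ENNReal.ofReal (Real.exp (-tailExponent A r z)) ≤ 1)
    (Fr : Fin n → Finset (Fin T)) (p : Signal n T) :
    volume.withDensity (referenceDensity A r Fr p) Set.univ ≤ 1 := by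
  rw [withDensity_apply _ .univ, Measure.restrict_univ]
  exact lintegral_referenceDensity_le hA Fr p

section Moments

variable (γ : LinkExponents) (snr : ℝ)

theorem lintegral_sq_gain_sr (i : Fin 2) (b : Fin n) :
    ∫⁻ ω, ‖ω.1.1 i b‖ₑ ^ 2 ∂(channelLaw γ snr n T) = strength snr (γ.sr i) := by
  have h1 : MeasurePreserving (fun ω : Fading n × Noise n T => ω.1) (channelLaw γ snr n T)
      (fadingLaw γ snr n) := measurePreserving_fst
  have h2 : MeasurePreserving (fun g : Fading n => g.1) (fadingLaw γ snr n) _ :=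
    measurePreserving_fst
  have h := ((measurePreserving_eval _ b).comp (measurePreserving_eval _ i)).comp (h2.comp h1)
  exact (h.lintegral_comp (f := fun z : ℂ => ‖z‖ₑ ^ 2) (by fun_prop)).trans
    (lintegral_sq_complexGaussian _)

theorem lintegral_sq_gain_rd (i : Fin 2) (b : Fin n) :
    ∫⁻ ω, ‖ω.1.2 i b‖ₑ ^ 2 ∂(channelLaw γ snr n T) = strength snr (γ.rd i) := by
  have h1 : MeasurePreserving (fun ω : Fading n × Noise n T => ω.1) (channelLaw γ snr n T)
      (fadingLaw γ snr n) := measurePreserving_fst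
  have h2 : MeasurePreserving (fun g : Fading n => g.2) (fadingLaw γ snr n) _ :=
    measurePreserving_snd
  have h := ((measurePreserving_eval _ b).comp (measurePreserving_eval _ i)).comp (h2.comp h1)
  exact (h.lintegral_comp (f := fun z : ℂ => ‖z‖ₑ ^ 2) (by fun_prop)).trans
    (lintegral_sq_complexGaussian _)

theorem lintegral_sq_noise_relay (i : Fin 2) (b : Fin n) (t : Fin T) :
    ∫⁻ ω, ‖ω.2.1 i b t‖ₑ ^ 2 ∂(channelLaw γ snr n T) = 1 := by
  have h1 : MeasurePreserving (fun ω : Fading n × Noise n T => ω.2) (channelLaw γ snr n T)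
      (noiseLaw n T) := measurePreserving_snd
  have h2 : MeasurePreserving (fun g : Noise n T => g.1) (noiseLaw n T) _ :=
    measurePreserving_fst
  have h := ((measurePreserving_eval (fun _ : Fin T => complexGaussian 1) t).comp
    ((measurePreserving_eval (fun _ : Fin n => Measure.pi fun _ : Fin T => complexGaussian 1)
      b).comp (measurePreserving_eval _ i))).comp (h2.comp h1)
  exact (h.lintegral_comp (f := fun z : ℂ => ‖z‖ₑ ^ 2) (by fun_prop)).trans
    (lintegral_sq_complexGaussian _)

theorem lintegral_sq_noise_dest (b : Fin n) (t : Fin T) :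
    ∫⁻ ω, ‖ω.2.2 b t‖ₑ ^ 2 ∂(channelLaw γ snr n T) = 1 := by
  have h1 : MeasurePreserving (fun ω : Fading n × Noise n T => ω.2) (channelLaw γ snr n T)
      (noiseLaw n T) := measurePreserving_snd
  have h2 : MeasurePreserving (fun g : Noise n T => g.2) (noiseLaw n T) _ :=
    measurePreserving_snd
  have h := ((measurePreserving_eval _ t).comp (measurePreserving_eval _ b)).comp (h2.comp h1)
  exact (h.lintegral_comp (f := fun z : ℂ => ‖z‖ₑ ^ 2) (by fun_prop)).trans
    (lintegral_sq_complexGaussian _)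

end Moments

theorem ofReal_norm_sq {E : Type*} [SeminormedAddGroup E] (z : E) :
    ENNReal.ofReal (‖z‖ ^ 2) = ‖z‖ₑ ^ 2 := by
  rw [ENNReal.ofReal_pow (norm_nonneg _), ofReal_norm]

/-- Mean of an exponent that is bounded in terms of second moments. -/
theorem sum_lintegral_exponent_le {Ω ι : Type*} [MeasurableSpace Ω] {P : Measure Ω}
    [IsProbabilityMeasure P] {J : Finset ι} {ℓ : Fin M → Ω → ℝ} {z : ι → Ω → ℝ}
    {v : Fin M → ι → Ω → ℝ} {a c N Z W : ℝ} (ha : 0 ≤ a) (hc : 0 ≤ c) (hZ : 0 ≤ Z) (hW : 0 ≤ W)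
    (hJ : (J.card : ℝ) ≤ N) (hz : ∀ j, Measurable (z j)) (hv : ∀ m j, Measurable (v m j))
    (hℓ : ∀ m ω, ℓ m ω ≤ ∑ j ∈ J, (a + c * z j ω + c * v m j ω))
    (hz1 : ∀ j, ∫⁻ ω, ENNReal.ofReal (z j ω) ∂P ≤ ENNReal.ofReal Z)
    (hv1 : ∑ m, ∑ j ∈ J, ∫⁻ ω, ENNReal.ofReal (v m j ω) ∂P ≤ ENNReal.ofReal (M * W)) :
    ∑ m, ∫⁻ ω, ENNReal.ofReal (ℓ m ω) ∂P ≤ ENNReal.ofReal (M * (N * (a + c * Z) + c * W)) := by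
  have h1 : ∀ m, ∫⁻ ω, ENNReal.ofReal (ℓ m ω) ∂P ≤ ENNReal.ofReal (N * (a + c * Z)) +
      ENNReal.ofReal c * ∑ j ∈ J, ∫⁻ ω, ENNReal.ofReal (v m j ω) ∂P := by
    intro m
    calc ∫⁻ ω, ENNReal.ofReal (ℓ m ω) ∂P
        ≤ ∫⁻ ω, ∑ j ∈ J, (ENNReal.ofReal a + ENNReal.ofReal c * ENNReal.ofReal (z j ω) +
            ENNReal.ofReal c * ENNReal.ofReal (v m j ω)) ∂P := by
          refine lintegral_mono fun ω => (ENNReal.ofReal_le_ofReal (hℓ m ω)).trans ?_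
          refine (Finset.le_sum_of_subadditive ENNReal.ofReal ENNReal.ofReal_zero.le
            (fun _ _ => ENNReal.ofReal_add_le) _ _).trans ?_
          refine Finset.sum_le_sum fun j _ => ?_
          rw [← ENNReal.ofReal_mul hc, ← ENNReal.ofReal_mul hc]
          exact ENNReal.ofReal_add_le.trans (by gcongr; exact ENNReal.ofReal_add_le)
      _ = ∑ j ∈ J, (ENNReal.ofReal a + ENNReal.ofReal c * ∫⁻ ω, ENNReal.ofReal (z j ω) ∂P +
            ENNReal.ofReal c * ∫⁻ ω, ENNReal.ofReal (v m j ω) ∂P) := by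
          have hzm := fun j => (hz j).ennreal_ofReal
          have hvm := fun j => (hv m j).ennreal_ofReal
          rw [lintegral_finsetSum _ (fun j _ => by
            have := hzm j; have := hvm j; fun_prop)]
          refine Finset.sum_congr rfl fun j _ => ?_
          rw [lintegral_add_right _ (by have := hvm j; fun_prop),
            lintegral_add_right _ (by have := hzm j; fun_prop), lintegral_const_mul _ (hzm j),
            lintegral_const_mul _ (hvm j)]
          simp
      _ ≤ ∑ j ∈ J, (ENNReal.ofReal (a + c * Z) +
            ENNReal.ofReal c * ∫⁻ ω, ENNReal.ofReal (v m j ω) ∂P) := by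
          refine Finset.sum_le_sum fun j _ => ?_
          rw [ENNReal.ofReal_add ha (by positivity), ENNReal.ofReal_mul hc]
          gcongr
          exact hz1 j
      _ ≤ _ := by
          rw [Finset.sum_add_distrib, ← Finset.mul_sum, Finset.sum_const, nsmul_eq_mul,
            ← ENNReal.ofReal_natCast, ← ENNReal.ofReal_mul (by positivity)]
          gcongr
  have hN : 0 ≤ N := le_trans (by positivity) hJ
  calc ∑ m, ∫⁻ ω, ENNReal.ofReal (ℓ m ω) ∂P
      ≤ ∑ m : Fin M, (ENNReal.ofReal (N * (a + c * Z)) +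
        ENNReal.ofReal c * ∑ j ∈ J, ∫⁻ ω, ENNReal.ofReal (v m j ω) ∂P) :=
        Finset.sum_le_sum fun m _ => h1 m
    _ ≤ ENNReal.ofReal (M * (N * (a + c * Z))) + ENNReal.ofReal c * ENNReal.ofReal (M * W) := by
        rw [Finset.sum_add_distrib, ← Finset.mul_sum, Finset.sum_const, nsmul_eq_mul,
          Finset.card_univ, Fintype.card_fin, ← ENNReal.ofReal_natCast,
          ← ENNReal.ofReal_mul (by positivity)]
        gcongr
    _ = _ := by
        rw [← ENNReal.ofReal_mul hc, ← ENNReal.ofReal_add (by positivity) (by positivity)]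
        congr 1; ring

/-- Logarithmic bound in terms of second moments for the power of `f + w`, `‖f‖² ≤ u v`. -/
theorem log_one_add_norm_sq_le {E : Type*} [SeminormedAddCommGroup E] {f w : E} {u v S : ℝ}
    (hu : 0 ≤ u) (hv : 0 ≤ v) (hS : 0 < S) (h : ‖f‖ ^ 2 ≤ u * v) :
    Real.log (1 + ‖f + w‖ ^ 2) ≤ Real.log 2 + Real.log (1 + S) + (u / S + ‖w‖ ^ 2) + v := by
  have h1 : ‖f + w‖ ^ 2 ≤ 2 * ‖f‖ ^ 2 + 2 * ‖w‖ ^ 2 := by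
    have h3 : ‖f + w‖ ^ 2 ≤ (‖f‖ + ‖w‖) ^ 2 := by gcongr; exact norm_add_le _ _
    nlinarith [sq_nonneg (‖f‖ - ‖w‖)]
  -- The product separates `u` from `v` under the logarithm. A code that knows the gains can make
  -- its power depend on them, so the mean of `u * v` is not controlled, but the separate means are.
  have h2 : 1 + ‖f + w‖ ^ 2 ≤ 2 * ((1 + S) * ((1 + u / S) * ((1 + ‖w‖ ^ 2) * (1 + v)))) := by
    have hu' : u ≤ (1 + S) * (1 + u / S) - 1 := by
      have : (1 + S) * (1 + u / S) = 1 + S + u / S + u := by field_simp; ring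
      have : 0 ≤ u / S := by positivity
      linarith
    have h4 : u * v ≤ ((1 + S) * (1 + u / S) - 1) * v := by gcongr
    set q := (1 + S) * (1 + u / S) with hq
    have hq1 : 1 ≤ q := by linarith
    have h5 : 2 * ((1 + S) * ((1 + u / S) * ((1 + ‖w‖ ^ 2) * (1 + v)))) =
      2 * (q * ((1 + ‖w‖ ^ 2) * (1 + v))) := by rw [hq]; ring
    rw [h5]
    have h6 : 0 ≤ (q - 1) * ‖w‖ ^ 2 := mul_nonneg (by linarith) (by positivity)
    have h7 : 0 ≤ q * (‖w‖ ^ 2 * v) := by positivity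
    nlinarith
  have hx : ∀ x : ℝ, 0 ≤ x → Real.log (1 + x) ≤ x := fun x hx => by
    linarith [Real.log_le_sub_one_of_pos (show 0 < 1 + x by linarith)]
  have e1 : 0 ≤ u / S := by positivity
  have e2 := hx _ e1
  have e3 := hx _ (sq_nonneg ‖w‖)
  have e4 := hx _ hv
  refine (Real.log_le_log (by positivity) h2).trans ?_
  rw [Real.log_mul (by positivity) (by positivity), Real.log_mul (by positivity) (by positivity),
    Real.log_mul (by positivity) (by positivity), Real.log_mul (by positivity) (by positivity)]
  linarith

theorem log_one_add_rpow_le {snr Γ : ℝ} (hs : 1 ≤ snr) (hΓ : 0 ≤ Γ) :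
    Real.log (1 + snr ^ Γ) ≤ Real.log 2 + Γ * Real.log snr := by
  have h1 : 1 ≤ snr ^ Γ := Real.one_le_rpow hs hΓ
  rw [← Real.log_rpow (by linarith), ← Real.log_mul (by norm_num) (by positivity)]
  exact Real.log_le_log (by positivity) (by linarith)

end

/-! ### Converses for training-based schemes and for the link from the source to relay 2. -/

section

theorem ConverseBound.of_slack {T : ℕ} {γ : LinkExponents} {K : ∀ n M : ℕ, Code n T M → Prop}
    {d D : ℝ} (hD : 0 ≤ D)
    (h : ∀ δ > 0, ∃ C : ℝ, 0 ≤ C ∧ ∀ snr : ℝ, 1 ≤ snr → ∀ (n M : ℕ) (c : Code n T M), K n M c →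
      c.PowerConstraint γ snr → ∀ L : ℝ, 0 < L →
        L * ∑ m, (channelLaw γ snr n T).real (c.correct m) ≤
          L * Real.exp L + M * n * ((d + δ * D) * Real.log snr + C)) :
    ConverseBound T γ K d := by
  intro d' hd
  -- `D + 1` instead of `D` covers `D = 0`.
  obtain ⟨C, hC, h⟩ := h ((d' - d) / (D + 1)) (div_pos (by linarith) (by linarith))
  refine ⟨C, hC, ?_⟩
  filter_upwards [eventually_ge_atTop 1] with snr hs n M c hc hp L hL
  refine (h snr hs n M c hc hp L hL).trans ?_
  have h1 : (d' - d) / (D + 1) * D ≤ d' - d := by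
    rw [div_mul_eq_mul_div, div_le_iff₀ (by linarith)]
    nlinarith
  have h2 : 0 ≤ Real.log snr := Real.log_nonneg hs
  gcongr
  linarith

variable {n T M : ℕ}

/-- Converse for a Gaussian channel whose output at the receiver is `f m + w`. -/
theorem gaussian_mul_sum_measureReal_le {Ω : Type*} [MeasurableSpace Ω] {P : Measure Ω}
    [IsProbabilityMeasure P] {E : Fin M → Set Ω} {f : Fin M → Ω → Signal n T}
    {w : Ω → Signal n T} {Fr : Fin n → Finset (Fin T)} {k : ℕ} {A δ Γ snr L : ℝ}
    {u : Fin n → Ω → ℝ} {v : Fin M → Fin n → Fin T → Ω → ℝ}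
    (hf : ∀ m, Measurable (f m)) (hw : Measurable w) (hu : ∀ b, Measurable (u b))
    (hv : ∀ m b t, Measurable (v m b t)) (hu0 : ∀ b ω, 0 ≤ u b ω) (hv0 : ∀ m b t ω, 0 ≤ v m b t ω)
    (hA : 0 ≤ A) (hδ : 0 < δ) (hΓ : 0 ≤ Γ) (hsnr : 1 ≤ snr) (hL : 0 < L)
    (hk : ∀ b, (Fr b).card ≤ k)
    (hfuv : ∀ m ω b t, ‖f m ω b t‖ ^ 2 ≤ u b ω * v m b t ω)
    (hu1 : ∀ b, ∫⁻ ω, ENNReal.ofReal (u b ω) ∂P ≤ ENNReal.ofReal (2 * snr ^ Γ))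
    (hw1 : ∀ b t, ∫⁻ ω, ‖w ω b t‖ₑ ^ 2 ∂P ≤ 1)
    (hv1 : ∑ m, ∑ b, ∑ t, ∫⁻ ω, ENNReal.ofReal (v m b t ω) ∂P ≤
      ENNReal.ofReal (M * (n * (2 * T))))
    (h1 : ∑ m, P (E m ∩ {ω | signalExponent A (1 + δ) Fr (f m ω + w ω) ≤ L}) ≤
      ENNReal.ofReal (Real.exp L)) :
    L * ∑ m, P.real (E m) ≤ L * Real.exp L + M * n * ((k * Γ + δ * (k * Γ)) * Real.log snr +
      (k * (A + (1 + δ) * (2 * Real.log 2 + 3)) + (1 + δ) * (2 * T))) := by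
  have hS : 0 < snr ^ Γ := by positivity
  have hlog : 0 ≤ Real.log snr := Real.log_nonneg hsnr
  have hlog2 : 0 ≤ Real.log 2 := Real.log_nonneg one_le_two
  have hlS : 0 ≤ Real.log (1 + snr ^ Γ) := Real.log_nonneg (by linarith)
  set a : ℝ := A + (1 + δ) * (Real.log 2 + Real.log (1 + snr ^ Γ)) with ha
  have hbt : ∀ b t, Measurable fun ω => w ω b t := fun b t =>
    measurable_pi_iff.1 (measurable_pi_iff.1 hw b) t
  -- The index set consists of the free symbols. `Z = 3` is two for the normalized gains, which may
  -- come from two relays, plus one for the noise; the factor two in `W` likewise leaves room for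
  -- the power of two relays.
  have key := sum_lintegral_exponent_le (P := P) (J := Finset.univ.sigma Fr)
    (ℓ := fun m ω => signalExponent A (1 + δ) Fr (f m ω + w ω))
    (z := fun j ω => u j.1 ω / snr ^ Γ + ‖w ω j.1 j.2‖ ^ 2)
    (v := fun m j ω => v m j.1 j.2 ω) (a := a) (c := 1 + δ) (N := n * k) (Z := 3)
    (W := n * (2 * T)) (by positivity) (by positivity) (by norm_num) (by positivity) ?_ ?_ ?_ ?_ ?_
    ?_
  · refine (mul_sum_measureReal_le P (fun m => ?_) hL (by positivity) h1 key).trans ?_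
    · exact (measurable_signalExponent A (1 + δ) Fr).comp ((hf m).add hw)
    have h2 := log_one_add_rpow_le hsnr hΓ
    have h3 : a + (1 + δ) * 3 ≤ A + (1 + δ) * (2 * Real.log 2 + 3) +
        (1 + δ) * (Γ * Real.log snr) := by
      rw [ha]
      nlinarith
    have h4 : (M : ℝ) * (n * k * (a + (1 + δ) * 3) + (1 + δ) * (n * (2 * T))) ≤
        M * (n * k * (A + (1 + δ) * (2 * Real.log 2 + 3) +
        (1 + δ) * (Γ * Real.log snr)) + (1 + δ) * (n * (2 * T))) := by gcongr
    linarith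
  · rw [Finset.card_sigma]
    push_cast
    calc ∑ b, ((Fr b).card : ℝ) ≤ ∑ _b : Fin n, (k : ℝ) :=
          Finset.sum_le_sum fun b _ => by exact_mod_cast hk b
      _ = n * k := by simp
  · intro j
    have := hu j.1
    have := hbt j.1 j.2
    fun_prop
  · exact fun m j => hv m j.1 j.2
  · intro m ω
    rw [Finset.sum_sigma]
    unfold signalExponent
    refine Finset.sum_le_sum fun b _ => Finset.sum_le_sum fun t _ => ?_
    have h2 := log_one_add_norm_sq_le (w := w ω b t) (hu0 b ω) (hv0 m b t ω) hS (hfuv m ω b t)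
    have h3 := mul_le_mul_of_nonneg_left h2 (show 0 ≤ 1 + δ by positivity)
    simp only [tailExponent, Pi.add_apply]
    rw [ha]
    linarith
  · intro j
    have h2 : ∀ ω, ENNReal.ofReal (u j.1 ω / snr ^ Γ + ‖w ω j.1 j.2‖ ^ 2) =
        ENNReal.ofReal (u j.1 ω) * ENNReal.ofReal ((snr ^ Γ)⁻¹) + ‖w ω j.1 j.2‖ₑ ^ 2 := by
      intro ω
      rw [ENNReal.ofReal_add (div_nonneg (hu0 _ _) hS.le) (by positivity), div_eq_mul_inv,
        ENNReal.ofReal_mul (hu0 _ _), ofReal_norm_sq]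
    simp_rw [h2]
    have hm := (hu j.1).ennreal_ofReal
    rw [lintegral_add_left (by fun_prop), lintegral_mul_const _ hm]
    calc _ ≤ ENNReal.ofReal (2 * snr ^ Γ) * ENNReal.ofReal ((snr ^ Γ)⁻¹) + 1 := by
          gcongr
          · exact hu1 j.1
          · exact hw1 j.1 j.2
      _ = ENNReal.ofReal 3 := by
          rw [← ENNReal.ofReal_mul (by positivity), mul_assoc, mul_inv_cancel₀ hS.ne',
            ← ENNReal.ofReal_one, ← ENNReal.ofReal_add (by norm_num) (by norm_num)]
          norm_num
  · refine le_trans (Finset.sum_le_sum fun m _ => ?_) hv1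
    rw [Finset.sum_sigma]
    exact Finset.sum_le_sum fun b _ => Finset.sum_le_sum_of_subset (Finset.subset_univ _)

theorem ofReal_natCast_mul (a b c : ℕ) :
    (a : ℝ≥0∞) * (b * c) = ENNReal.ofReal (a * (b * c)) := by
  rw [ENNReal.ofReal_mul (by positivity), ENNReal.ofReal_mul (by positivity)]
  simp

theorem exists_tailExponent {δ : ℝ} (hδ : 0 < δ) :
    ∃ A : ℝ, 0 ≤ A ∧ ∫⁻ z : ℂ, ENNReal.ofReal (Real.exp (-tailExponent A (1 + δ) z)) ≤ 1 :=
  exists_lintegral_exp_neg_le_one ℂ (by rw [Complex.finrank_real_complex]; push_cast; linarith)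

namespace Code

/-- With pilots from the relays in `S`, at most `T - |S|` symbols of a block are free. -/
theorem RelaysTrain.exists_free {c : Code n T M} {S : Finset (Fin 2)} (h : c.RelaysTrain S) :
    ∃ (Fr : Fin n → Finset (Fin T)) (p : Fin n → Fin 2 → Fin T → ℂ),
      (∀ b, (Fr b).card ≤ T - S.card) ∧
      ∀ b, ∀ i ∈ S, ∀ g y, ∀ t ∉ Fr b, c.relay i g y b t = p b i t := by
  choose P p hli hp using h
  refine ⟨fun b => (P b)ᶜ, p, fun b => ?_, fun b i hi g y t ht =>
    hp b i hi g y t (by simpa using ht)⟩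
  -- Independent sequences on `P b` number at most `|P b|`; hence `|S| ≤ T`, and the subtraction in
  -- `T - S.card` is not truncated.
  have h1 := (hli b).fintype_card_le_finrank
  simp only [Fintype.card_coe, Module.finrank_fintype_fun_eq_card] at h1
  rw [Finset.card_compl, Fintype.card_fin]
  omega

end Code

/-- The cut around the destination, for training-based schemes. -/
theorem converseBound_training (γ : LinkExponents) (S : Finset (Fin 2)) {Γ : ℝ} (hΓ0 : 0 ≤ Γ)
    (hΓ : ∀ i ∈ S, γ.rd i ≤ Γ) :
    ConverseBound T γ (fun _ _ c => c.Training S) ((T - S.card : ℕ) * Γ) := by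
  refine ConverseBound.of_slack (D := (T - S.card : ℕ) * Γ) (by positivity) fun δ hδ => ?_
  obtain ⟨A, hA, hA1⟩ := exists_tailExponent hδ
  have hlog2 : 0 ≤ Real.log 2 := Real.log_nonneg one_le_two
  refine ⟨((T - S.card : ℕ) : ℝ) * (A + (1 + δ) * (2 * Real.log 2 + 3)) + (1 + δ) * (2 * T),
    by positivity, fun snr hsnr n M c hc hp L hL => ?_⟩
  obtain ⟨hsil, -, htr⟩ := hc
  obtain ⟨Fr, p, hk, hpil⟩ := htr.exists_free
  have hx : ∀ m i b t, Measurable fun ω => c.relayOutput m ω i b t := fun m i b t =>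
    measurable_pi_iff.1 (measurable_pi_iff.1 (c.measurable_relayOutput m i) b) t
  have hfm : ∀ m, Measurable fun (ω : Fading n × Noise n T) b t =>
      ∑ i, ω.1.2 i b * c.relayOutput m ω i b t := by
    intro m
    refine measurable_pi_lambda _ fun b => measurable_pi_lambda _ fun t => ?_
    have := fun i => hx m i b t
    fun_prop
  have hS0 : 0 ≤ snr ^ Γ := by positivity
  refine gaussian_mul_sum_measureReal_le (P := channelLaw γ snr n T) (E := c.correct) (Fr := Fr)
    (f := fun m ω b t => ∑ i, ω.1.2 i b * c.relayOutput m ω i b t) (w := fun ω => ω.2.2)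
    (u := fun b ω => ∑ i ∈ S, ‖ω.1.2 i b‖ ^ 2)
    (v := fun m b t ω => ∑ i, ‖c.relayOutput m ω i b t‖ ^ 2)
    hfm (by fun_prop) (fun b => by fun_prop) (fun m b t => ?_)
    (fun b ω => by positivity) (fun m b t ω => by positivity) hA hδ hΓ0 hsnr hL hk ?_ ?_ ?_ ?_ ?_
  · have := fun i => hx m i b t
    fun_prop
  · intro m ω b t
    have hz : ∀ i ∉ S, c.relayOutput m ω i b t = 0 := fun i hi => hsil i hi _ _ b t
    have e1 : ∑ i, ω.1.2 i b * c.relayOutput m ω i b t =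
        ∑ i ∈ S, ω.1.2 i b * c.relayOutput m ω i b t :=
      (Finset.sum_subset (Finset.subset_univ S) fun i _ hi => by rw [hz i hi, mul_zero]).symm
    have e2 : ∑ i, ‖c.relayOutput m ω i b t‖ ^ 2 = ∑ i ∈ S, ‖c.relayOutput m ω i b t‖ ^ 2 :=
      (Finset.sum_subset (Finset.subset_univ S) fun i _ hi => by rw [hz i hi]; simp).symm
    simp only [e1, e2]
    calc _ ≤ (∑ i ∈ S, ‖ω.1.2 i b‖ * ‖c.relayOutput m ω i b t‖) ^ 2 := by
          gcongr
          -- After the triangle inequality, Cauchy–Schwarz separates gains from transmitted powers.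
          refine (norm_sum_le _ _).trans (le_of_eq ?_)
          exact Finset.sum_congr rfl fun i _ => norm_mul _ _
      _ ≤ _ := Finset.sum_mul_sq_le_sq_mul_sq _ _ _
  · intro b
    simp_rw [fun ω : Fading n × Noise n T => ENNReal.ofReal_sum_of_nonneg (s := S)
      (f := fun i => ‖ω.1.2 i b‖ ^ 2) fun i _ => sq_nonneg _, ofReal_norm_sq]
    rw [lintegral_finsetSum _ fun i _ => by fun_prop]
    simp_rw [lintegral_sq_gain_rd]
    calc ∑ i ∈ S, (strength snr (γ.rd i) : ℝ≥0∞) ≤ ∑ _i ∈ S, ENNReal.ofReal (snr ^ Γ) :=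
          Finset.sum_le_sum fun i hi =>
            ENNReal.ofReal_le_ofReal (Real.rpow_le_rpow_of_exponent_le hsnr (hΓ i hi))
      _ ≤ ∑ _i : Fin 2, ENNReal.ofReal (snr ^ Γ) :=
          Finset.sum_le_sum_of_subset (Finset.subset_univ _)
      _ = ENNReal.ofReal (2 * snr ^ Γ) := by
          rw [ENNReal.ofReal_mul two_pos.le]; simp
  · exact fun b t => (lintegral_sq_noise_dest γ snr b t).le
  · have e1 : ∀ m b t, ∫⁻ ω, ENNReal.ofReal (∑ i, ‖c.relayOutput m ω i b t‖ ^ 2)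
        ∂(channelLaw γ snr n T) =
        ∑ i, ∫⁻ ω, ‖c.relayOutput m ω i b t‖ₑ ^ 2 ∂(channelLaw γ snr n T) := by
      intro m b t
      simp_rw [fun ω : Fading n × Noise n T => ENNReal.ofReal_sum_of_nonneg (s := Finset.univ)
        (f := fun i => ‖c.relayOutput m ω i b t‖ ^ 2) fun i _ => sq_nonneg _, ofReal_norm_sq]
      rw [lintegral_finsetSum _ fun i _ => by have := hx m i b t; fun_prop]
    simp_rw [e1, Fin.sum_univ_two, Finset.sum_add_distrib]
    refine (add_le_add (hp.2 0) (hp.2 1)).trans (le_of_eq ?_)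
    rw [ofReal_natCast_mul, ← ENNReal.ofReal_add (by positivity) (by positivity)]
    congr 1; ring
  · refine sum_prod_le (fun m => (c.measurableSet_correct m).inter (measurableSet_le
      ((measurable_signalExponent A (1 + δ) Fr).comp ((hfm m).add (by fun_prop)))
      measurable_const)) fun g => ?_
    -- The noiseless output at pilot times. It depends on the gains alone, not on the message or the
    -- relay noise, so it may enter the reference density once `g` is frozen.
    let pil : Signal n T := fun b t => ∑ i, g.2 i b * (if i ∈ S then p b i t else 0)
    have hdec : Measurable (c.decode g) := c.measurable_decode.comp measurable_prodMk_left
    refine sum_measure_le_of_dominated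
      (withDensity_referenceDensity_univ_le hA1 Fr pil) hdec fun m => ?_
    rw [noiseLaw, Measure.prod_apply]
    · calc _ ≤ ∫⁻ _ : Fin 2 → Signal n T, ENNReal.ofReal (Real.exp L) *
            volume.withDensity (referenceDensity A (1 + δ) Fr pil) (c.decode g ⁻¹' {m})
            ∂(Measure.pi fun _ => signalNoise n T) := by
            refine lintegral_mono fun r => ?_
            exact signalNoise_inter_le (a := fun b t =>
              ∑ i, g.2 i b * c.relayOutput m (g, (r, 0)) i b t) Fr (fun b t ht =>
              Finset.sum_congr rfl fun i _ => by
                congr 1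
                split_ifs with hi
                · exact hpil b i hi _ _ t ht
                · exact hsil i hi _ _ b t) (hdec (measurableSet_singleton m)) L
        _ = _ := by simp
    · exact measurable_prodMk_left ((c.measurableSet_correct m).inter (measurableSet_le
        ((measurable_signalExponent A (1 + δ) Fr).comp ((hfm m).add (by fun_prop)))
        measurable_const))

/-- The cut between the source and the second relay, if the first relay is silent. -/
theorem converseBound_silent_zero (γ : LinkExponents) (hγ : 0 ≤ γ.sr 1) :
    ConverseBound T γ (fun _ _ c => c.Silent 0) (T * γ.sr 1) := by
  refine ConverseBound.of_slack (D := T * γ.sr 1) (by positivity) fun δ hδ => ?_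
  obtain ⟨A, hA, hA1⟩ := exists_tailExponent hδ
  have hlog2 : 0 ≤ Real.log 2 := Real.log_nonneg one_le_two
  refine ⟨(T : ℝ) * (A + (1 + δ) * (2 * Real.log 2 + 3)) + (1 + δ) * (2 * T),
    by positivity, fun snr hsnr n M c hsil hp L hL => ?_⟩
  have hx : ∀ m b t, Measurable fun ω : Fading n × Noise n T => c.source ω.1 m b t :=
    fun m b t => measurable_pi_iff.1 (measurable_pi_iff.1
      ((c.measurable_source m).comp measurable_fst) b) t
  have hfm : ∀ m, Measurable fun (ω : Fading n × Noise n T) b t =>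
      ω.1.1 1 b * c.source ω.1 m b t := by
    intro m
    refine measurable_pi_lambda _ fun b => measurable_pi_lambda _ fun t => ?_
    have := hx m b t
    fun_prop
  have hS0 : 0 ≤ snr ^ γ.sr 1 := by positivity
  let Fr : Fin n → Finset (Fin T) := fun _ => Finset.univ
  have hmE : ∀ m, MeasurableSet (c.correct m ∩ {ω : Fading n × Noise n T |
      signalExponent A (1 + δ) Fr ((fun b t => ω.1.1 1 b * c.source ω.1 m b t) + ω.2.1 1)
        ≤ L}) := fun m =>
    (c.measurableSet_correct m).inter (measurableSet_le
      ((measurable_signalExponent A (1 + δ) Fr).comp ((hfm m).add (by fun_prop)))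
      measurable_const)
  refine gaussian_mul_sum_measureReal_le (P := channelLaw γ snr n T) (E := c.correct)
    (Fr := Fr) (f := fun m ω b t => ω.1.1 1 b * c.source ω.1 m b t) (w := fun ω => ω.2.1 1)
    (u := fun b ω => ‖ω.1.1 1 b‖ ^ 2) (v := fun m b t ω => ‖c.source ω.1 m b t‖ ^ 2)
    hfm (by fun_prop) (fun b => by fun_prop) (fun m b t => ?_)
    (fun b ω => by positivity) (fun m b t ω => by positivity) hA hδ hγ hsnr hL
    (fun b => by simp [Fr]) ?_ ?_ ?_ ?_ ?_
  · have := hx m b t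
    fun_prop
  · intro m ω b t
    rw [norm_mul, mul_pow]
  · intro b
    simp_rw [ofReal_norm_sq, lintegral_sq_gain_sr]
    exact ENNReal.ofReal_le_ofReal (by linarith)
  · exact fun b t => (lintegral_sq_noise_relay γ snr 1 b t).le
  · simp_rw [ofReal_norm_sq]
    refine hp.1.trans ?_
    rw [ofReal_natCast_mul]
    refine ENNReal.ofReal_le_ofReal ?_
    gcongr
    have : (0 : ℝ) ≤ T := by positivity
    linarith
  · refine sum_prod_le hmE fun g => ?_
    have hmg := fun m => measurable_prodMk_left (x := g) (hmE m)
    rw [noiseLaw]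
    -- With the gains, the destination noise and the noise of relay 1 frozen, the only remaining
    -- randomness is the noise of relay 2.
    refine sum_prod_le_symm hmg fun wd => ?_
    have hmw := fun m => measurable_prodMk_right (y := wd) (hmg m)
    have hpi := measurePreserving_piFinTwo fun _ : Fin 2 => signalNoise n T
    have hpi' := fun s => (hpi.symm.measure_preimage_equiv s).symm
    simp_rw [hpi']
    refine sum_prod_le (fun m => (MeasurableEquiv.measurable _) (hmw m)) fun w₀ => ?_
    -- Everything behind relay 2, including the destination, acts as one decoder for the signal `y`
    -- received by that relay.
    have hdec : Measurable fun y : Signal n T =>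
        c.decode g (fun b t => g.2 1 b * c.relay 1 g y b t + wd b t) := by
      refine c.measurable_decode.comp (measurable_const.prodMk ?_)
      refine measurable_pi_lambda _ fun b => measurable_pi_lambda _ fun t => ?_
      have : Measurable fun y => c.relay 1 g y b t :=
        measurable_pi_iff.1 (measurable_pi_iff.1
          ((c.measurable_relay 1).comp measurable_prodMk_left) b) t
      fun_prop
    refine sum_measure_le_of_dominated
      (withDensity_referenceDensity_univ_le hA1 Fr 0) hdec fun m => ?_
    refine le_trans (measure_mono ?_) (signalNoise_inter_le
      (a := fun b t => g.1 1 b * c.source g m b t) Fr (fun b t ht => (ht (by simp [Fr])).elim)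
      (hdec (measurableSet_singleton m)) L)
    rintro w₁ ⟨h1, h2⟩
    refine ⟨?_, h2⟩
    have h1' : c.decode g (c.destInput m (g, ((MeasurableEquiv.piFinTwo
      fun _ : Fin 2 => Signal n T).symm (w₀, w₁), wd))) = m := h1
    rw [Set.mem_preimage, Set.mem_singleton_iff]
    convert h1' using 2
    funext b t
    simp only [Code.destInput, Fin.sum_univ_two]
    rw [show c.relayOutput m _ 0 b t = 0 from hsil _ _ b t, mul_zero, zero_add]
    rfl

end

/-! ### Converse for relay 1 alone without channel knowledge. -/

section

variable {n T M : ℕ}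

/-- The density of a block `g x + w` with a Gaussian gain `g` unknown to the receiver. -/
theorem lintegral_prod_complexGaussianPDF_le (hT : 0 < T) {s : ℝ≥0} (hs : s ≠ 0)
    (x y : Fin T → ℂ) :
    ∫⁻ g, ∏ t, complexGaussianPDF 1 (y t - g * x t) ∂(complexGaussian s) ≤
      ENNReal.ofReal ((1 + s * ‖x‖ ^ 2)⁻¹) := by
  have : Nonempty (Fin T) := ⟨⟨0, hT⟩⟩
  -- The norm on `Fin T → ℂ` is the maximum norm, so the strongest symbol alone yields the bound;
  -- the other factors are at most one.
  obtain ⟨t₀, ht₀⟩ := Finite.exists_max fun t => ‖x t‖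
  have hx : ‖x‖ ≤ ‖x t₀‖ := (pi_norm_le_iff_of_nonneg (norm_nonneg _)).2 ht₀
  calc _ ≤ ∫⁻ g, complexGaussianPDF 1 (y t₀ - g * x t₀) ∂(complexGaussian s) := by
        refine lintegral_mono fun g => ?_
        dsimp only
        rw [← Finset.mul_prod_erase _ _ (Finset.mem_univ t₀)]
        exact mul_le_of_le_one_right' (Finset.prod_le_one' fun t _ => complexGaussianPDF_one_le _)
    _ ≤ ENNReal.ofReal ((1 + s * ‖x t₀‖ ^ 2)⁻¹) := lintegral_complexGaussianPDF_sub_mul_le hs _ _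
    _ ≤ _ := by gcongr

/-- Log-likelihood exponent of the noncoherent channel with input `x` and output `y`. -/
def blockExponent (A r : ℝ) (s : ℝ≥0) (x y : Signal n T) : ℝ :=
  ∑ b, (tailExponent A r (y b) - Real.log (1 + s * ‖x b‖ ^ 2))

theorem measurable_blockExponent {Ω : Type*} [MeasurableSpace Ω] (A r : ℝ) (s : ℝ≥0)
    {x y : Ω → Signal n T} (hx : Measurable x) (hy : Measurable y) :
    Measurable fun ω => blockExponent A r s (x ω) (y ω) := by
  unfold blockExponent
  refine Finset.measurable_sum _ fun b _ =>
    ((measurable_tailExponent (E := Fin T → ℂ) A r).comp (measurable_pi_iff.1 hy b)).sub ?_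
  have : Measurable fun ω => ‖x ω b‖ := (measurable_pi_iff.1 hx b).norm
  fun_prop

/-- Reference density for the output of the noncoherent channel. -/
def blockDensity (A r : ℝ) (y : Signal n T) : ℝ≥0∞ :=
  ∏ b, ENNReal.ofReal (Real.exp (-tailExponent A r (y b)))

theorem withDensity_blockDensity_univ_le {A r : ℝ}
    (hA : ∫⁻ z : Fin T → ℂ, ENNReal.ofReal (Real.exp (-tailExponent A r z)) ≤ 1) :
    (volume : Measure (Signal n T)).withDensity (blockDensity A r) Set.univ ≤ 1 := by
  rw [withDensity_apply _ .univ, Measure.restrict_univ]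
  have h := measurable_tailExponent (E := Fin T → ℂ) A r
  have h1 := lintegral_pi_prod (n := n) (μ := fun _ => (volume : Measure (Fin T → ℂ)))
    (f := fun _ y => ENNReal.ofReal (Real.exp (-tailExponent A r y))) fun _ => by fun_prop
  refine le_trans (le_of_eq h1) ?_
  exact Finset.prod_le_one' fun b _ => hA

/-- By Fubini the gains can be averaged first, for a fixed output. The average factorizes over
blocks because the gains are independent, and each factor is at most `(1 + s * ‖x b‖ ^ 2)⁻¹`,
precisely what `blockExponent` subtracts in logarithmic form. -/
theorem lintegral_signalNoise_inter_le (hT : 0 < T) {A r : ℝ} {s : ℝ≥0} (hs : s ≠ 0)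
    (x : Signal n T) {D : Set (Signal n T)} (hD : MeasurableSet D) (L : ℝ) :
    ∫⁻ g : Fin n → ℂ, signalNoise n T {w | (fun b t => g b * x b t) + w ∈
        D ∩ {y | blockExponent A r s x y ≤ L}} ∂(Measure.pi fun _ => complexGaussian s) ≤
      ENNReal.ofReal (Real.exp L) * volume.withDensity (blockDensity A r) D := by
  have hme : Measurable fun y : Signal n T => blockExponent A r s x y :=
    measurable_blockExponent A r s measurable_const measurable_id
  have hset := hD.inter (measurableSet_le hme (measurable_const (a := L)))
  simp_rw [fun g : Fin n → ℂ => signalNoise_add_mem (fun b t => g b * x b t) hset]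
  have hpm := measurable_complexGaussianPDF 1
  rw [lintegral_lintegral_swap]
  · refine withDensity_inter_le hme (fun y => ?_) hD L
    rw [lintegral_pi_prod (f := fun b g => ∏ t, complexGaussianPDF 1 (y b t - g * x b t))
      fun b => Finset.measurable_prod _ fun t _ => hpm.comp (by fun_prop)]
    have h1 : ENNReal.ofReal (Real.exp (blockExponent A r s x y)) * blockDensity A r y =
        ∏ b, ENNReal.ofReal ((1 + s * ‖x b‖ ^ 2)⁻¹) := by
      rw [blockExponent, blockDensity, Real.exp_sum,
        ENNReal.ofReal_prod_of_nonneg fun _ _ => (Real.exp_pos _).le, ← Finset.prod_mul_distrib]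
      refine Finset.prod_congr rfl fun b _ => ?_
      rw [← ENNReal.ofReal_mul (Real.exp_pos _).le, ← Real.exp_add]
      congr 1
      rw [show tailExponent A r (y b) - Real.log (1 + s * ‖x b‖ ^ 2) + -tailExponent A r (y b) =
        -Real.log (1 + s * ‖x b‖ ^ 2) by ring, Real.exp_neg, Real.exp_log (by positivity)]
    rw [h1]
    exact Finset.prod_le_prod' fun b _ => lintegral_prod_complexGaussianPDF_le hT hs _ _
  · refine Measurable.aemeasurable ?_
    exact Finset.measurable_prod _ fun b _ => Finset.measurable_prod _ fun t _ =>
      hpm.comp (by fun_prop)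

/-- Bound on the exponent of one block in terms of second moments. -/
theorem tailExponent_sub_log_le (hT : 0 < T) {A δ s : ℝ} (hδ : 0 < δ) (hs : 0 < s) (g : ℂ)
    (x w : Fin T → ℂ) :
    tailExponent A (T + δ) (g • x + w) - Real.log (1 + s * ‖x‖ ^ 2) ≤
      (A + (T - 1 + δ) * (Real.log 2 + Real.log (1 + s))) +
        (T + 1 + δ) * (‖g‖ ^ 2 / s + ∑ t, ‖w t‖ ^ 2) + (T + 1 + δ) * ∑ t, ‖x t‖ ^ 2 := by
  have hn : ∀ z : Fin T → ℂ, ‖z‖ ^ 2 ≤ ∑ t, ‖z t‖ ^ 2 := by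
    intro z
    have : Nonempty (Fin T) := ⟨⟨0, hT⟩⟩
    obtain ⟨t₀, ht₀⟩ := Finite.exists_max fun t => ‖z t‖
    calc ‖z‖ ^ 2 ≤ ‖z t₀‖ ^ 2 := by
          gcongr
          exact (pi_norm_le_iff_of_nonneg (norm_nonneg _)).2 ht₀
      _ ≤ _ := Finset.single_le_sum (f := fun t => ‖z t‖ ^ 2) (fun t _ => sq_nonneg _)
          (Finset.mem_univ t₀)
  have hT1 : (1 : ℝ) ≤ T := by exact_mod_cast hT
  -- The tail weight is split as `T + δ = (T - 1 + δ) + 1`. `h1` is used with weight `T - 1 + δ` and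
  -- costs `log (1 + s)`; `h2` is used once and its main term cancels against `log (1 + s * ‖x‖ ^
  -- 2)`.
  have h1 := log_one_add_norm_sq_le (f := g • x) (w := w) (u := ‖g‖ ^ 2) (v := ‖x‖ ^ 2) (S := s)
    (by positivity) (by positivity) hs (by rw [norm_smul, mul_pow])
  have h2 : Real.log (1 + ‖g • x + w‖ ^ 2) ≤
      Real.log (1 + s * ‖x‖ ^ 2) + 2 * (‖g‖ ^ 2 / s + ‖w‖ ^ 2) := by
    have e1 : ‖g • x + w‖ ^ 2 ≤ 2 * (‖g‖ ^ 2 * ‖x‖ ^ 2) + 2 * ‖w‖ ^ 2 := by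
      have e2 : ‖g • x + w‖ ^ 2 ≤ (‖g‖ * ‖x‖ + ‖w‖) ^ 2 := by
        gcongr; rw [← norm_smul]; exact norm_add_le _ _
      nlinarith [sq_nonneg (‖g‖ * ‖x‖ - ‖w‖)]
    have e3 : 1 + ‖g • x + w‖ ^ 2 ≤
        (1 + s * ‖x‖ ^ 2) * (1 + 2 * (‖g‖ ^ 2 / s + ‖w‖ ^ 2)) := by
      have e4 : (1 + s * ‖x‖ ^ 2) * (1 + 2 * (‖g‖ ^ 2 / s + ‖w‖ ^ 2)) =
          1 + 2 * (‖g‖ ^ 2 * ‖x‖ ^ 2) + 2 * ‖w‖ ^ 2 +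
            (2 * (‖g‖ ^ 2 / s) + s * ‖x‖ ^ 2 + 2 * s * ‖x‖ ^ 2 * ‖w‖ ^ 2) := by
        field_simp; ring
      rw [e4]
      have : 0 ≤ 2 * (‖g‖ ^ 2 / s) + s * ‖x‖ ^ 2 + 2 * s * ‖x‖ ^ 2 * ‖w‖ ^ 2 := by positivity
      linarith
    refine (Real.log_le_log (by positivity) e3).trans ?_
    rw [Real.log_mul (by positivity) (by positivity)]
    have := Real.log_le_sub_one_of_pos
      (show 0 < 1 + 2 * (‖g‖ ^ 2 / s + ‖w‖ ^ 2) by positivity)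
    linarith
  have h3 := mul_le_mul_of_nonneg_left h1 (show 0 ≤ (T : ℝ) - 1 + δ by linarith)
  have hw := mul_le_mul_of_nonneg_left (hn w) (show 0 ≤ (T : ℝ) + 1 + δ by linarith)
  have hx := mul_le_mul_of_nonneg_left (hn x) (show 0 ≤ (T : ℝ) + 1 + δ by linarith)
  have hx2 : 0 ≤ ‖x‖ ^ 2 := by positivity
  unfold tailExponent
  linarith

/-- Likelihood bound for the correct decisions of a noncoherent code with a single relay. -/
theorem Code.Noncoherent.correct_inter_le (hT : 0 < T) {γ : LinkExponents} {snr : ℝ} {A r₀ : ℝ}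
    {s : ℝ≥0} (hs : s = strength snr (γ.rd 0)) (hsne : s ≠ 0) {c : Code n T M}
    (hnc : c.Noncoherent)
    (hdest : ∀ m (ω : Fading n × Noise n T), c.destInput m ω =
      (fun b t => ω.1.2 0 b * c.relayOutput m ω 0 b t) + ω.2.2) (L : ℝ) (m : Fin M)
    (hmE : MeasurableSet (c.correct m ∩ {ω | blockExponent A r₀ s
      (c.relayOutput m ω 0) (c.destInput m ω) ≤ L})) :
    channelLaw γ snr n T (c.correct m ∩ {ω | blockExponent A r₀ s
      (c.relayOutput m ω 0) (c.destInput m ω) ≤ L}) ≤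
      ENNReal.ofReal (Real.exp L) *
        volume.withDensity (blockDensity A r₀) (c.decode 0 ⁻¹' {m}) := by
  have hdec : Measurable (c.decode 0) := c.measurable_decode.comp measurable_prodMk_left
  have hD := hdec (measurableSet_singleton m)
  -- Without channel knowledge the relay signal is a function of the source-side gains `h` and the
  -- relay noise `r` only. It is therefore independent of the gain to the destination, which can be
  -- averaged with `X h r` fixed.
  let X : (Fin 2 → Fin n → ℂ) → (Fin 2 → Signal n T) → Signal n T := fun h r =>
    c.relay 0 0 fun b t => h 0 b * c.source 0 m b t + r 0 b t
  have hX : ∀ h g r w, c.relayOutput m ((h, g), (r, w)) 0 = X h r := by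
    intro h g r w
    unfold Code.relayOutput Code.relayInput
    dsimp only
    rw [(hnc (h, g) 0).1, (hnc (h, g) 0).2.1 0]
  have hsec : ∀ h g r, Prod.mk r ⁻¹' (Prod.mk (h, g) ⁻¹' (c.correct m ∩
      {ω | blockExponent A r₀ s (c.relayOutput m ω 0) (c.destInput m ω) ≤ L})) =
      {w | (fun b t => g 0 b * X h r b t) + w ∈
        (c.decode 0 ⁻¹' {m}) ∩ {y | blockExponent A r₀ s (X h r) y ≤ L}} := by
    intro h g r
    ext w
    simp only [Set.mem_preimage, Set.mem_inter_iff, Set.mem_ofPred_eq, Code.correct, hdest, hX,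
      (hnc (h, g) 0).2.2, Set.mem_singleton_iff]
  unfold channelLaw noiseLaw
  rw [Measure.prod_apply hmE, fadingLaw, lintegral_prod _
    (measurable_measure_prodMk_left hmE).aemeasurable]
  refine le_trans (lintegral_mono (g := fun _ => ENNReal.ofReal (Real.exp L) *
    volume.withDensity (blockDensity A r₀) (c.decode 0 ⁻¹' {m})) fun h => ?_) (by simp)
  have hsw : ∀ g, (Measure.pi fun _ : Fin 2 => signalNoise n T).prod (signalNoise n T)
      (Prod.mk (h, g) ⁻¹' (c.correct m ∩ {ω | blockExponent A r₀ s
        (c.relayOutput m ω 0) (c.destInput m ω) ≤ L})) =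
      ∫⁻ r, signalNoise n T {w | (fun b t => g 0 b * X h r b t) + w ∈ (c.decode 0 ⁻¹' {m}) ∩
        {y | blockExponent A r₀ s (X h r) y ≤ L}}
        ∂(Measure.pi fun _ : Fin 2 => signalNoise n T) := by
    intro g
    rw [Measure.prod_apply (measurable_prodMk_left hmE)]
    simp_rw [hsec]
  simp_rw [hsw]
  rw [lintegral_lintegral_swap]
  · refine le_trans (lintegral_mono (g := fun _ => ENNReal.ofReal (Real.exp L) *
      volume.withDensity (blockDensity A r₀) (c.decode 0 ⁻¹' {m})) fun r => ?_) (by simp)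
    refine le_trans (le_of_eq ?_) (lintegral_signalNoise_inter_le hT hsne (X h r) hD L)
    rw [hs]
    have hev := measurePreserving_eval (fun i : Fin 2 => Measure.pi fun _ : Fin n =>
      complexGaussian (strength snr (γ.rd i))) 0
    refine hev.lintegral_comp (f := fun g : Fin n → ℂ => signalNoise n T
      {w | (fun b t => g b * X h r b t) + w ∈ (c.decode 0 ⁻¹' {m}) ∩
        {y | blockExponent A r₀ (strength snr (γ.rd 0)) (X h r) y ≤ L}}) ?_
    have hme : Measurable fun y : Signal n T => blockExponent A r₀ (strength snr (γ.rd 0))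
        (X h r) y :=
      measurable_blockExponent A r₀ (strength snr (γ.rd 0)) measurable_const measurable_id
    refine measurable_measure_prodMk_left (s := {q : (Fin n → ℂ) × Signal n T |
      (fun b t => q.1 b * X h r b t) + q.2 ∈ (c.decode 0 ⁻¹' {m}) ∩
        {y | blockExponent A r₀ (strength snr (γ.rd 0)) (X h r) y ≤ L}}) ?_
    refine (show Measurable fun q : (Fin n → ℂ) × Signal n T =>
      (fun b t => q.1 b * X h r b t) + q.2 from ?_)
      (hD.inter (measurableSet_le hme measurable_const))
    refine measurable_pi_lambda _ fun b => measurable_pi_lambda _ fun t => ?_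
    simp only [Pi.add_apply]
    fun_prop
  · have hm2 : MeasurableSet {q : ((Fin 2 → Fin n → ℂ) × (Fin 2 → Signal n T)) × Signal n T |
        ((h, q.1.1), (q.1.2, q.2)) ∈ c.correct m ∩ {ω | blockExponent A r₀ s
          (c.relayOutput m ω 0) (c.destInput m ω) ≤ L}} :=
      (show Measurable fun q : ((Fin 2 → Fin n → ℂ) × (Fin 2 → Signal n T)) × Signal n T =>
        (((h, q.1.1), (q.1.2, q.2)) : Fading n × Noise n T) by fun_prop) hmE
    have hm3 : MeasurableSet {q : ((Fin 2 → Fin n → ℂ) × (Fin 2 → Signal n T)) × Signal n T |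
        (fun b t => q.1.1 0 b * X h q.1.2 b t) + q.2 ∈ (c.decode 0 ⁻¹' {m}) ∩
          {y | blockExponent A r₀ s (X h q.1.2) y ≤ L}} := by
      convert hm2 using 1
      ext q
      exact (Set.ext_iff.1 (hsec h q.1.1 q.1.2) q.2).symm
    exact (measurable_measure_prodMk_left (ν := signalNoise n T) hm3).aemeasurable

/-- The relay to destination link for a single relay without channel knowledge. -/
theorem converseBound_noncoherent (hT : 0 < T) (γ : LinkExponents) (hγ : 0 ≤ γ.rd 0) :
    ConverseBound T γ (fun _ _ c => c.Noncoherent ∧ c.Silent 1) ((T - 1) * γ.rd 0) := by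
  have hT1 : (1 : ℝ) ≤ T := by exact_mod_cast hT
  refine ConverseBound.of_slack hγ fun δ hδ => ?_
  -- A whole block has real dimension `2 T`, hence the tail exponent just above `T`.
  obtain ⟨A, hA, hA1⟩ := exists_lintegral_exp_neg_le_one (Fin T → ℂ) (r := T + δ) (by
    rw [Module.finrank_pi_fintype]; simp; linarith)
  have hlog2 : 0 ≤ Real.log 2 := Real.log_nonneg one_le_two
  have hTδ : 0 ≤ (T : ℝ) - 1 + δ := by linarith
  refine ⟨A + (T - 1 + δ) * (2 * Real.log 2) + (T + 1 + δ) * (1 + T) + (T + 1 + δ) * T,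
    by positivity, fun snr hsnr n M c hc hp L hL => ?_⟩
  obtain ⟨hnc, hsil⟩ := hc
  have hs0 : 0 < snr ^ γ.rd 0 := by positivity
  have hlS : 0 ≤ Real.log (1 + snr ^ γ.rd 0) := Real.log_nonneg (by linarith)
  set s : ℝ≥0 := strength snr (γ.rd 0) with hs
  have hsr : (s : ℝ) = snr ^ γ.rd 0 := Real.coe_toNNReal _ hs0.le
  have hsne : s ≠ 0 := by
    intro h
    rw [h] at hsr
    simp only [NNReal.coe_zero] at hsr
    linarith
  have hdest : ∀ m (ω : Fading n × Noise n T), c.destInput m ω =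
      (fun b t => ω.1.2 0 b * c.relayOutput m ω 0 b t) + ω.2.2 := by
    intro m ω
    funext b t
    simp only [Code.destInput, Fin.sum_univ_two, Pi.add_apply]
    rw [show c.relayOutput m ω 1 b t = 0 from hsil _ _ b t, mul_zero, add_zero]
  have hx : ∀ m b t, Measurable fun ω => c.relayOutput m ω 0 b t := fun m b t =>
    measurable_pi_iff.1 (measurable_pi_iff.1 (c.measurable_relayOutput m 0) b) t
  have hℓm : ∀ m, Measurable fun ω => blockExponent A (T + δ) s (c.relayOutput m ω 0)
      (c.destInput m ω) := fun m =>
    measurable_blockExponent A (T + δ) s (c.measurable_relayOutput m 0)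
      (c.measurable_destInput m)
  have hmE : ∀ m, MeasurableSet (c.correct m ∩ {ω | blockExponent A (T + δ) s
      (c.relayOutput m ω 0) (c.destInput m ω) ≤ L}) := fun m =>
    (c.measurableSet_correct m).inter (measurableSet_le (hℓm m) measurable_const)
  have key := sum_lintegral_exponent_le (P := channelLaw γ snr n T) (J := Finset.univ)
    (ℓ := fun m ω => blockExponent A (T + δ) s (c.relayOutput m ω 0) (c.destInput m ω))
    (z := fun (b : Fin n) ω => ‖ω.1.2 0 b‖ ^ 2 / s + ∑ t, ‖ω.2.2 b t‖ ^ 2)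
    (v := fun m b ω => ∑ t, ‖c.relayOutput m ω 0 b t‖ ^ 2)
    (a := A + (T - 1 + δ) * (Real.log 2 + Real.log (1 + s))) (c := T + 1 + δ) (N := n)
    (Z := 1 + T) (W := n * T) (by rw [hsr]; positivity) (by positivity) (by positivity)
    (by positivity) (by simp) (fun b => by fun_prop)
    (fun m b => by have := hx m b; fun_prop) ?_ ?_ ?_
  · refine (mul_sum_measureReal_le (channelLaw γ snr n T) hℓm hL
      (by rw [hsr]; positivity) ?_ key).trans ?_
    · refine sum_measure_le_of_dominated (withDensity_blockDensity_univ_le hA1)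
        (dec := c.decode 0) (c.measurable_decode.comp measurable_prodMk_left) fun m => ?_
      exact hnc.correct_inter_le hT hs hsne hdest L m (hmE m)
    · have h2 := log_one_add_rpow_le hsnr hγ
      rw [← hsr] at h2
      have h3 := mul_le_mul_of_nonneg_left h2 hTδ
      have h4 : (n : ℝ) * (A + (T - 1 + δ) * (Real.log 2 + Real.log (1 + s)) +
          (T + 1 + δ) * (1 + T)) + (T + 1 + δ) * (n * T) ≤
          n * (((T - 1) * γ.rd 0 + δ * γ.rd 0) * Real.log snr + (A + (T - 1 + δ) *
            (2 * Real.log 2) + (T + 1 + δ) * (1 + T) + (T + 1 + δ) * T)) := by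
        have h6 : A + (T - 1 + δ) * (Real.log 2 + Real.log (1 + s)) +
            (T + 1 + δ) * (1 + T) + (T + 1 + δ) * T ≤
            ((T - 1) * γ.rd 0 + δ * γ.rd 0) * Real.log snr + (A + (T - 1 + δ) *
              (2 * Real.log 2) + (T + 1 + δ) * (1 + T) + (T + 1 + δ) * T) := by linarith
        have h7 := mul_le_mul_of_nonneg_left h6 (show (0 : ℝ) ≤ n by positivity)
        linarith
      have h5 := mul_le_mul_of_nonneg_left h4 (show (0 : ℝ) ≤ M by positivity)
      linarith
  · intro m ω
    unfold blockExponent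
    refine Finset.sum_le_sum fun b _ => ?_
    have hb : c.destInput m ω b = ω.1.2 0 b • c.relayOutput m ω 0 b + ω.2.2 b := by
      rw [hdest]; rfl
    rw [hb]
    exact tailExponent_sub_log_le hT hδ (by rw [hsr]; exact hs0) _ _ _
  · intro b
    have h2 : ∀ ω : Fading n × Noise n T,
        ENNReal.ofReal (‖ω.1.2 0 b‖ ^ 2 / s + ∑ t, ‖ω.2.2 b t‖ ^ 2) =
        ‖ω.1.2 0 b‖ₑ ^ 2 * ENNReal.ofReal ((s : ℝ)⁻¹) + ∑ t, ‖ω.2.2 b t‖ₑ ^ 2 := by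
      intro ω
      rw [ENNReal.ofReal_add (by positivity) (by positivity), div_eq_mul_inv,
        ENNReal.ofReal_mul (by positivity), ofReal_norm_sq,
        ENNReal.ofReal_sum_of_nonneg fun _ _ => sq_nonneg _]
      simp_rw [ofReal_norm_sq]
    simp_rw [h2]
    rw [lintegral_add_left (by fun_prop), lintegral_mul_const _ (by fun_prop),
      lintegral_finsetSum _ fun t _ => by fun_prop]
    simp_rw [lintegral_sq_gain_rd, lintegral_sq_noise_dest]
    rw [← hs, ← ENNReal.ofReal_coe_nnreal, ← ENNReal.ofReal_mul (by positivity),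
      mul_inv_cancel₀ (by rw [hsr]; exact hs0.ne'),
      ENNReal.ofReal_add (by norm_num) (by positivity)]
    simp
  · have e1 : ∀ m b, ∫⁻ ω, ENNReal.ofReal (∑ t, ‖c.relayOutput m ω 0 b t‖ ^ 2)
        ∂(channelLaw γ snr n T) =
        ∑ t, ∫⁻ ω, ‖c.relayOutput m ω 0 b t‖ₑ ^ 2 ∂(channelLaw γ snr n T) := by
      intro m b
      simp_rw [fun ω : Fading n × Noise n T => ENNReal.ofReal_sum_of_nonneg (s := Finset.univ)
        (f := fun t => ‖c.relayOutput m ω 0 b t‖ ^ 2) fun i _ => sq_nonneg _, ofReal_norm_sq]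
      rw [lintegral_finsetSum _ fun t _ => by have := hx m b t; fun_prop]
    simp_rw [e1]
    exact (hp.2 0).trans (le_of_eq (ofReal_natCast_mul _ _ _))

end

/-! ### The optimization problem behind the upper bound. -/

section Objective

theorem log_one_add_mul_le {s p l : ℝ} (hs : 1 ≤ s) (hl : Real.log s = l) (hp : 0 ≤ p) :
    Real.log (1 + s * p) ≤ l + p := by
  have h1 : Real.log (1 + s * p) ≤ Real.log (s * (1 + p)) :=
    Real.log_le_log (by positivity) (by linarith)
  rw [Real.log_mul (by positivity) (by positivity), hl] at h1
  linarith [Real.log_le_sub_one_of_pos (show 0 < 1 + p by linarith)]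

/-- Pointwise bound for the combination of the two objectives with weights `2/3` and `1/3`. -/
theorem log_objective_le {s₁ s₂ l p q r : ℝ} (hs₁ : 1 ≤ s₁) (hs₂ : 1 ≤ s₂)
    (h₁ : Real.log s₁ = 2 * l) (h₂ : Real.log s₂ = 3 * l) (hl : 0 ≤ l)
    (hp : 0 ≤ p) (hq : 0 ≤ q) (hr : 0 ≤ r) :
    2 * Real.log (s₂ * p + s₁ * q + s₁ * r + 3) + 1 / 3 * Real.log (s₂ * p + s₁ * q + 1)
      + 2 / 3 * Real.log (s₁ * r + 2)
      - Real.log (s₂ * p + s₁ * q + s₁ * r + s₁ * s₂ * r * p + 1)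
      ≤ 4 * l + (2 * Real.log 3 + Real.log 2) + 2 * (p + (q + r)) := by
  have ha := log_one_add_mul_le hs₂ h₂ hp
  have hb := log_one_add_mul_le hs₁ h₁ hq
  have hc := log_one_add_mul_le hs₁ h₁ hr
  have a0 : 0 ≤ s₂ * p := by positivity
  have b0 : 0 ≤ s₁ * q := by positivity
  have c0 : 0 ≤ s₁ * r := by positivity
  have e : s₁ * s₂ * r * p = (s₂ * p) * (s₁ * r) := by ring
  rw [e]
  generalize s₂ * p = a at *
  generalize s₁ * q = b at *
  generalize s₁ * r = c at *
  have ac0 : 0 ≤ a * c := by positivity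
  have la0 := Real.log_nonneg (show 1 ≤ 1 + a by linarith)
  have lb0 := Real.log_nonneg (show 1 ≤ 1 + b by linarith)
  have lc0 := Real.log_nonneg (show 1 ≤ 1 + c by linarith)
  have h1 : Real.log (c + 2) ≤ Real.log 2 + Real.log (1 + c) := by
    rw [← Real.log_mul (by norm_num) (by positivity)]
    exact Real.log_le_log (by positivity) (by linarith)
  -- The subtracted logarithm dominates both `log ((1 + a) (1 + c))` and `log (1 + b)`. The second
  -- bound is used when `b` is the largest of the three, the first otherwise.
  have h2 : Real.log (1 + a) + Real.log (1 + c) ≤ Real.log (a + b + c + a * c + 1) := by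
    rw [← Real.log_mul (by positivity) (by positivity)]
    exact Real.log_le_log (by positivity) (by linarith)
  have h3 : Real.log (1 + b) ≤ Real.log (a + b + c + a * c + 1) :=
    Real.log_le_log (by positivity) (by linarith)
  have h4 : Real.log (a + b + 1) ≤ Real.log 2 + max (Real.log (1 + a)) (Real.log (1 + b)) := by
    rcases le_total a b with h | h
    · refine le_trans ?_ (add_le_add_right (le_max_right _ _) _)
      rw [← Real.log_mul (by norm_num) (by positivity)]
      exact Real.log_le_log (by positivity) (by linarith)
    · refine le_trans ?_ (add_le_add_right (le_max_left _ _) _)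
      rw [← Real.log_mul (by norm_num) (by positivity)]
      exact Real.log_le_log (by positivity) (by linarith)
  have h5 : ∀ x, 0 ≤ x → a ≤ x → b ≤ x → c ≤ x →
      Real.log (a + b + c + 3) ≤ Real.log 3 + Real.log (1 + x) := by
    intro x hx h h' h''
    rw [← Real.log_mul (by norm_num) (by positivity)]
    exact Real.log_le_log (by positivity) (by linarith)
  have mono : ∀ {x y : ℝ}, 0 ≤ x → x ≤ y → Real.log (1 + x) ≤ Real.log (1 + y) :=
    fun hx hxy => Real.log_le_log (by linarith) (by linarith)
  rcases le_total a b with hab | hab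
  · rw [max_eq_right (mono a0 hab)] at h4
    rcases le_total b c with hbc | hbc
    · have := h5 c c0 (hab.trans hbc) hbc le_rfl
      have := mono b0 hbc
      linarith
    · have := h5 b b0 hab le_rfl hbc
      have := mono c0 hbc
      linarith
  · rw [max_eq_left (mono b0 hab)] at h4
    rcases le_total a c with hac | hac
    · have := h5 c c0 hac (hab.trans hac) le_rfl
      have := mono a0 hac
      linarith
    · have := h5 a a0 le_rfl hab hac
      have := mono c0 hac
      linarith

variable {p : Measure (ℂ × ℂ × ℂ)}

theorem Feasible.integrable_fst (h : Feasible 3 p) :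
    Integrable (fun x : ℂ × ℂ × ℂ => ‖x.1‖ ^ 2) p ∧ ∫ x, ‖x.1‖ ^ 2 ∂p ≤ 3 := by
  have h1 : ∫⁻ x, ENNReal.ofReal (‖x.1‖ ^ 2) ∂p ≤ 3 := by
    simp_rw [ofReal_norm_sq]; exact_mod_cast h.2.1
  have hm : Measurable fun x : ℂ × ℂ × ℂ => ‖x.1‖ ^ 2 := by fun_prop
  have h0 : 0 ≤ᵐ[p] fun x : ℂ × ℂ × ℂ => ‖x.1‖ ^ 2 := ae_of_all _ fun _ => sq_nonneg _
  refine ⟨(lintegral_ofReal_ne_top_iff_integrable hm.aestronglyMeasurable h0).1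
    (h1.trans_lt (by simp)).ne, ?_⟩
  rw [integral_eq_lintegral_of_nonneg_ae h0 hm.aestronglyMeasurable]
  exact ENNReal.toReal_le_of_le_ofReal (by norm_num) (by simpa using h1)

theorem Feasible.integrable_snd (h : Feasible 3 p) :
    Integrable (fun x : ℂ × ℂ × ℂ => ‖x.2.1‖ ^ 2 + ‖x.2.2‖ ^ 2) p ∧
      ∫ x, (‖x.2.1‖ ^ 2 + ‖x.2.2‖ ^ 2) ∂p ≤ 3 := by
  have h1 : ∫⁻ x, ENNReal.ofReal (‖x.2.1‖ ^ 2 + ‖x.2.2‖ ^ 2) ∂p ≤ 3 := by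
    simp_rw [fun x : ℂ × ℂ × ℂ => ENNReal.ofReal_add (sq_nonneg ‖x.2.1‖) (sq_nonneg ‖x.2.2‖),
      ofReal_norm_sq]
    exact_mod_cast h.2.2
  have hm : Measurable fun x : ℂ × ℂ × ℂ => ‖x.2.1‖ ^ 2 + ‖x.2.2‖ ^ 2 := by fun_prop
  have h0 : 0 ≤ᵐ[p] fun x : ℂ × ℂ × ℂ => ‖x.2.1‖ ^ 2 + ‖x.2.2‖ ^ 2 :=
    ae_of_all _ fun _ => by positivity
  refine ⟨(lintegral_ofReal_ne_top_iff_integrable hm.aestronglyMeasurable h0).1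
    (h1.trans_lt (by simp)).ne, ?_⟩
  rw [integral_eq_lintegral_of_nonneg_ae h0 hm.aestronglyMeasurable]
  exact ENNReal.toReal_le_of_le_ofReal (by norm_num) (by simpa using h1)

/-- The logarithm of the product is at most a constant plus a linear function of the powers, which
are integrable by feasibility. Integrability matters since a Bochner integral that does not exist
has the value zero. -/
theorem Feasible.integrable_log {s₁ s₂ : ℝ} (h : Feasible 3 p) (hs₁ : 0 ≤ s₁) (hs₂ : 0 ≤ s₂)
    {f : ℂ × ℂ × ℂ → ℝ} (hf : Measurable f) (hf1 : ∀ x, 1 ≤ f x)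
    (hf2 : ∀ x, f x ≤ 3 * ((1 + s₂ * ‖x.1‖ ^ 2) *
      ((1 + s₁ * ‖x.2.1‖ ^ 2) * (1 + s₁ * ‖x.2.2‖ ^ 2)))) :
    Integrable (fun x => Real.log (f x)) p := by
  have := h.1
  refine Integrable.mono' (g := fun x => Real.log 3 + s₂ * ‖x.1‖ ^ 2 +
    s₁ * (‖x.2.1‖ ^ 2 + ‖x.2.2‖ ^ 2)) ?_
    (Real.measurable_log.comp hf).aestronglyMeasurable (ae_of_all _ fun x => ?_)
  · exact ((integrable_const _).add (h.integrable_fst.1.const_mul _)).add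
      (h.integrable_snd.1.const_mul _)
  · rw [Real.norm_of_nonneg (Real.log_nonneg (hf1 x))]
    refine (Real.log_le_log (by linarith [hf1 x]) (hf2 x)).trans ?_
    have hx : ∀ x : ℝ, 0 ≤ x → Real.log (1 + x) ≤ x := fun x hx => by
      linarith [Real.log_le_sub_one_of_pos (show 0 < 1 + x by linarith)]
    have h1 := hx (s₂ * ‖x.1‖ ^ 2) (by positivity)
    have h2 := hx (s₁ * ‖x.2.1‖ ^ 2) (by positivity)
    have h3 := hx (s₁ * ‖x.2.2‖ ^ 2) (by positivity)
    rw [Real.log_mul (by positivity) (by positivity), Real.log_mul (by positivity) (by positivity),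
      Real.log_mul (by positivity) (by positivity)]
    linarith

theorem integral_combination_le {X : Type*} [MeasurableSpace X] {μ : Measure X}
    {f₁ f₂ f₃ f₄ g : X → ℝ} {c₁ c₂ c₃ : ℝ} (h₁ : Integrable f₁ μ) (h₂ : Integrable f₂ μ)
    (h₃ : Integrable f₃ μ) (h₄ : Integrable f₄ μ) (hg : Integrable g μ)
    (h : ∀ x, c₁ * f₁ x + c₂ * f₂ x + c₃ * f₃ x - f₄ x ≤ g x) :
    c₁ * ∫ x, f₁ x ∂μ + c₂ * ∫ x, f₂ x ∂μ + c₃ * ∫ x, f₃ x ∂μ - ∫ x, f₄ x ∂μ ≤ ∫ x, g x ∂μ := by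
  have i₁ : Integrable (fun x => c₁ * f₁ x + c₂ * f₂ x) μ := (h₁.const_mul _).add (h₂.const_mul _)
  have i₂ : Integrable (fun x => c₁ * f₁ x + c₂ * f₂ x + c₃ * f₃ x) μ := i₁.add (h₃.const_mul _)
  rw [← integral_const_mul, ← integral_const_mul, ← integral_const_mul,
    ← integral_add (h₁.const_mul _) (h₂.const_mul _), ← integral_add i₁ (h₃.const_mul _),
    ← integral_sub i₂ h₄]
  exact integral_mono (i₂.sub h₄) hg h

/-- Weak duality: the minimum is at most the average with weights `2/3` and `1/3`. In units of `l`,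
the two atoms of `mixedLaw` give the pairs of objectives `(6, 2)` and `(4, 6)`; these weights are
the ones for which both pairs average to `14/3`. -/
theorem Feasible.min_objective_le {s₁ s₂ l : ℝ} (h : Feasible 3 p) (hs₁ : 1 ≤ s₁) (hs₂ : 1 ≤ s₂)
    (h₁ : Real.log s₁ = 2 * l) (h₂ : Real.log s₂ = 3 * l) (hl : 0 ≤ l) :
    min (psi1 3 s₁ s₂ p) (2 * (l / Real.log 2) + psi2 3 s₁ s₂ p) ≤
      (14 / 3 * l + (2 * Real.log 3 + Real.log 2 + 12)) / Real.log 2 := by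
  have := h.1
  have hlog2 : 0 < Real.log 2 := Real.log_pos one_lt_two
  have i1 : Integrable (fun x : ℂ × ℂ × ℂ => Real.log (s₂ * ‖x.1‖ ^ 2 + s₁ * ‖x.2.1‖ ^ 2 +
      s₁ * ‖x.2.2‖ ^ 2 + 3)) p := by
    refine h.integrable_log (s₁ := s₁) (s₂ := s₂) (by linarith) (by linarith) (by fun_prop)
      (fun x => ?_) fun x => ?_
    · have : 0 ≤ s₂ * ‖x.1‖ ^ 2 + s₁ * ‖x.2.1‖ ^ 2 + s₁ * ‖x.2.2‖ ^ 2 := by positivity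
      linarith
    · have a0 : 0 ≤ s₂ * ‖x.1‖ ^ 2 := by positivity
      have b0 : 0 ≤ s₁ * ‖x.2.1‖ ^ 2 := by positivity
      have c0 : 0 ≤ s₁ * ‖x.2.2‖ ^ 2 := by positivity
      generalize s₂ * ‖x.1‖ ^ 2 = a at *
      generalize s₁ * ‖x.2.1‖ ^ 2 = b at *
      generalize s₁ * ‖x.2.2‖ ^ 2 = c at *
      have : 0 ≤ a * b + b * c + a * c + a * b * c := by positivity
      linarith
  have i2 : Integrable (fun x : ℂ × ℂ × ℂ => Real.log (s₂ * ‖x.1‖ ^ 2 + s₁ * ‖x.2.1‖ ^ 2 +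
      s₁ * ‖x.2.2‖ ^ 2 + s₁ * s₂ * ‖x.2.2‖ ^ 2 * ‖x.1‖ ^ 2 + 1)) p := by
    refine h.integrable_log (s₁ := s₁) (s₂ := s₂) (by linarith) (by linarith) (by fun_prop)
      (fun x => ?_) fun x => ?_
    · have : 0 ≤ s₂ * ‖x.1‖ ^ 2 + s₁ * ‖x.2.1‖ ^ 2 + s₁ * ‖x.2.2‖ ^ 2 +
        s₁ * s₂ * ‖x.2.2‖ ^ 2 * ‖x.1‖ ^ 2 := by positivity
      linarith
    · have a0 : 0 ≤ s₂ * ‖x.1‖ ^ 2 := by positivity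
      have b0 : 0 ≤ s₁ * ‖x.2.1‖ ^ 2 := by positivity
      have c0 : 0 ≤ s₁ * ‖x.2.2‖ ^ 2 := by positivity
      have e : s₁ * s₂ * ‖x.2.2‖ ^ 2 * ‖x.1‖ ^ 2 = s₂ * ‖x.1‖ ^ 2 * (s₁ * ‖x.2.2‖ ^ 2) := by ring
      rw [e]
      generalize s₂ * ‖x.1‖ ^ 2 = a at *
      generalize s₁ * ‖x.2.1‖ ^ 2 = b at *
      generalize s₁ * ‖x.2.2‖ ^ 2 = c at *
      have : 0 ≤ 3 * (a * b) + 3 * (b * c) + 2 * (a * c) + 3 * (a * b * c) := by positivity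
      linarith
  have i3 : Integrable (fun x : ℂ × ℂ × ℂ => Real.log (s₂ * ‖x.1‖ ^ 2 + s₁ * ‖x.2.1‖ ^ 2 + 1))
      p := by
    refine h.integrable_log (s₁ := s₁) (s₂ := s₂) (by linarith) (by linarith) (by fun_prop)
      (fun x => ?_) fun x => ?_
    · have : 0 ≤ s₂ * ‖x.1‖ ^ 2 + s₁ * ‖x.2.1‖ ^ 2 := by positivity
      linarith
    · have a0 : 0 ≤ s₂ * ‖x.1‖ ^ 2 := by positivity
      have b0 : 0 ≤ s₁ * ‖x.2.1‖ ^ 2 := by positivity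
      have c0 : 0 ≤ s₁ * ‖x.2.2‖ ^ 2 := by positivity
      generalize s₂ * ‖x.1‖ ^ 2 = a at *
      generalize s₁ * ‖x.2.1‖ ^ 2 = b at *
      generalize s₁ * ‖x.2.2‖ ^ 2 = c at *
      have : 0 ≤ a * b + b * c + a * c + a * b * c := by positivity
      linarith
  have i4 : Integrable (fun x : ℂ × ℂ × ℂ => Real.log (s₁ * ‖x.2.2‖ ^ 2 + 2)) p := by
    refine h.integrable_log (s₁ := s₁) (s₂ := s₂) (by linarith) (by linarith) (by fun_prop)
      (fun x => ?_) fun x => ?_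
    · have : 0 ≤ s₁ * ‖x.2.2‖ ^ 2 := by positivity
      linarith
    · have a0 : 0 ≤ s₂ * ‖x.1‖ ^ 2 := by positivity
      have b0 : 0 ≤ s₁ * ‖x.2.1‖ ^ 2 := by positivity
      have c0 : 0 ≤ s₁ * ‖x.2.2‖ ^ 2 := by positivity
      generalize s₂ * ‖x.1‖ ^ 2 = a at *
      generalize s₁ * ‖x.2.1‖ ^ 2 = b at *
      generalize s₁ * ‖x.2.2‖ ^ 2 = c at *
      have : 0 ≤ a * b + b * c + a * c + a * b * c := by positivity
      linarith
  have key : 2 * ∫ x, Real.log (s₂ * ‖x.1‖ ^ 2 + s₁ * ‖x.2.1‖ ^ 2 + s₁ * ‖x.2.2‖ ^ 2 + 3) ∂p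
      + 1 / 3 * ∫ x, Real.log (s₂ * ‖x.1‖ ^ 2 + s₁ * ‖x.2.1‖ ^ 2 + 1) ∂p
      + 2 / 3 * ∫ x, Real.log (s₁ * ‖x.2.2‖ ^ 2 + 2) ∂p
      - ∫ x, Real.log (s₂ * ‖x.1‖ ^ 2 + s₁ * ‖x.2.1‖ ^ 2 + s₁ * ‖x.2.2‖ ^ 2
        + s₁ * s₂ * ‖x.2.2‖ ^ 2 * ‖x.1‖ ^ 2 + 1) ∂p
      -- The constant `12` is twice the sum of the two power budgets of `3`.
      ≤ 4 * l + (2 * Real.log 3 + Real.log 2) + 12 := by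
    obtain ⟨j1, k1⟩ := h.integrable_fst
    obtain ⟨j2, k2⟩ := h.integrable_snd
    have j3 : Integrable (fun x : ℂ × ℂ × ℂ => 2 * (‖x.1‖ ^ 2 + (‖x.2.1‖ ^ 2 + ‖x.2.2‖ ^ 2))) p :=
      (j1.add j2).const_mul 2
    have j4 : Integrable (fun x : ℂ × ℂ × ℂ => 4 * l + (2 * Real.log 3 + Real.log 2) +
        2 * (‖x.1‖ ^ 2 + (‖x.2.1‖ ^ 2 + ‖x.2.2‖ ^ 2))) p := (integrable_const _).add j3
    refine (integral_combination_le i1 i3 i4 i2 j4 fun x =>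
      log_objective_le hs₁ hs₂ h₁ h₂ hl (sq_nonneg ‖x.1‖) (sq_nonneg ‖x.2.1‖)
        (sq_nonneg ‖x.2.2‖)).trans ?_
    rw [integral_add (integrable_const _) j3, integral_const_mul, integral_add j1 j2]
    simp only [integral_const, probReal_univ, smul_eq_mul, one_mul]
    linarith
  have hle : min (psi1 3 s₁ s₂ p) (2 * (l / Real.log 2) + psi2 3 s₁ s₂ p) ≤
      2 / 3 * psi1 3 s₁ s₂ p + 1 / 3 * (2 * (l / Real.log 2) + psi2 3 s₁ s₂ p) := by
    have m1 := min_le_left (psi1 3 s₁ s₂ p) (2 * (l / Real.log 2) + psi2 3 s₁ s₂ p)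
    have m2 := min_le_right (psi1 3 s₁ s₂ p) (2 * (l / Real.log 2) + psi2 3 s₁ s₂ p)
    linarith
  refine hle.trans ?_
  simp only [psi1, psi2, Real.logb, integral_div]
  norm_num only [Nat.cast_ofNat]
  refine le_trans (le_of_eq ?_) (div_le_div_of_nonneg_right
    (add_le_add_left key (2 / 3 * l)) hlog2.le) |>.trans (le_of_eq ?_)
  · ring
  · ring

/-- The law which attains the upper bound up to a constant. -/
def mixedLaw : Measure (ℂ × ℂ × ℂ) :=
  ENNReal.ofReal (1 / 3) • Measure.dirac (1, 0, 0) +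
    ENNReal.ofReal (2 / 3) • Measure.dirac (0, 1, 1)

theorem integral_mixedLaw (f : ℂ × ℂ × ℂ → ℝ) :
    ∫ x, f x ∂mixedLaw = 1 / 3 * f (1, 0, 0) + 2 / 3 * f (0, 1, 1) := by
  have hi : ∀ (a : ℂ × ℂ × ℂ) (c : ℝ), Integrable f (ENNReal.ofReal c • Measure.dirac a) :=
    fun a c => (integrable_dirac (by simp)).smul_measure ENNReal.ofReal_ne_top
  rw [mixedLaw, integral_add_measure (hi _ _) (hi _ _), integral_smul_measure,
    integral_smul_measure, integral_dirac, integral_dirac, ENNReal.toReal_ofReal (by norm_num),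
    ENNReal.toReal_ofReal (by norm_num)]
  simp

theorem feasible_mixedLaw : Feasible 3 mixedLaw := by
  have hsum : ENNReal.ofReal (1 / 3) + ENNReal.ofReal (2 / 3) = 1 := by
    rw [← ENNReal.ofReal_add (by norm_num) (by norm_num)]; norm_num
  have h1 : ENNReal.ofReal (1 / 3) ≤ 1 := by rw [← hsum]; exact le_self_add
  have h2 : ENNReal.ofReal (2 / 3) ≤ 1 := by rw [← hsum]; exact le_add_self
  refine ⟨⟨?_⟩, ?_, ?_⟩
  · simp only [mixedLaw, Measure.coe_add, Measure.coe_smul, Pi.add_apply, Pi.smul_apply,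
      measure_univ, smul_eq_mul, mul_one, hsum]
  · simp only [mixedLaw, lintegral_add_measure, lintegral_smul_measure, lintegral_dirac,
      smul_eq_mul]
    simp only [enorm_one, enorm_zero, one_pow, mul_one, ne_eq, OfNat.ofNat_ne_zero,
      not_false_eq_true, zero_pow, mul_zero, add_zero]
    exact h1.trans (by norm_num)
  · simp only [mixedLaw, lintegral_add_measure, lintegral_smul_measure, lintegral_dirac,
      smul_eq_mul]
    simp only [enorm_one, enorm_zero, one_pow, ne_eq, OfNat.ofNat_ne_zero,
      not_false_eq_true, zero_pow, mul_zero, add_zero, zero_add]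
    calc ENNReal.ofReal (2 / 3) * (1 + 1) ≤ 1 * (1 + 1) := by gcongr
      _ ≤ ((3 : ℕ) : ℝ≥0∞) := by norm_num

theorem le_min_objective_mixedLaw {s₁ s₂ l : ℝ} (hs₁ : 1 ≤ s₁) (hs₂ : 1 ≤ s₂)
    (h₁ : Real.log s₁ = 2 * l) (h₂ : Real.log s₂ = 3 * l) :
    14 / 3 * l / Real.log 2 ≤
      min (psi1 3 s₁ s₂ mixedLaw) (2 * (l / Real.log 2) + psi2 3 s₁ s₂ mixedLaw) := by
  have hlog2 : 0 < Real.log 2 := Real.log_pos one_lt_two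
  have a1 : Real.log (s₂ + 1) ≤ Real.log (s₂ + 3) :=
    Real.log_le_log (by linarith) (by linarith)
  have a2 : 3 * l ≤ Real.log (s₂ + 3) := by
    rw [← h₂]; exact Real.log_le_log (by linarith) (by linarith)
  have a3 : Real.log (s₁ + s₁ + 1) ≤ Real.log (s₁ + s₁ + 3) :=
    Real.log_le_log (by linarith) (by linarith)
  have a4 : 2 * l ≤ Real.log (s₁ + s₁ + 3) := by
    rw [← h₁]; exact Real.log_le_log (by linarith) (by linarith)
  have a5 : Real.log (s₁ + s₁ + 1) ≤ Real.log 2 + Real.log (s₁ + 1) := by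
    rw [← Real.log_mul (by norm_num) (by linarith)]
    exact Real.log_le_log (by linarith) (by linarith)
  have a6 : 2 * l ≤ Real.log (s₁ + 2) := by
    rw [← h₁]; exact Real.log_le_log (by linarith) (by linarith)
  refine le_min ?_ ?_
  · simp only [psi1, integral_mixedLaw, Real.logb]
    norm_num only [norm_one, norm_zero, Nat.cast_ofNat, mul_one, mul_zero, add_zero, zero_add,
      one_pow]
    -- The `s₂` atom contributes `1/3 * (9 - 3) * l` and the `s₁` atom `2/3 * (6 - 2) * l`, in total
    -- `14/3 * l`.
    rw [div_le_iff₀ hlog2]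
    field_simp
    rw [show s₁ * (1 + 1) = s₁ + s₁ by ring]
    linarith
  · simp only [psi2, integral_mixedLaw, Real.logb]
    norm_num only [norm_one, norm_zero, Nat.cast_ofNat, mul_one, mul_zero, add_zero, zero_add,
      one_pow]
    -- The terms of `(1, 0, 0)` cancel except for `2/3 * log 2`, which pays for the loss in `a5`.
    -- The other atom gives `8/3 * l`, and the source link the missing `2 * l`.
    rw [div_le_iff₀ hlog2]
    field_simp
    rw [show s₁ * (1 + 1) = s₁ + s₁ by ring]
    linarith

end Objective

/-- The upper bound in the example network. -/
theorem tendsto_upperBound :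
    Tendsto (fun snr : ℝ => upperBound 3 { sr := ![4, 1], rd := ![2, 3] } snr / Real.logb 2 snr)
      atTop (𝓝 (14 / 3)) := by
  have hlog2 : 0 < Real.log 2 := Real.log_pos one_lt_two
  set C : ℝ := 2 * Real.log 3 + Real.log 2 + 12 with hC
  have hbounds : ∀ᶠ snr : ℝ in atTop,
      14 / 3 ≤ upperBound 3 { sr := ![4, 1], rd := ![2, 3] } snr / Real.logb 2 snr ∧
      upperBound 3 { sr := ![4, 1], rd := ![2, 3] } snr / Real.logb 2 snr ≤
        14 / 3 + C / Real.log snr := by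
    filter_upwards [eventually_gt_atTop 1] with snr hsnr
    have hl : 0 < Real.log snr := Real.log_pos hsnr
    have hs0 : 0 < snr := by linarith
    have hs₁ : 1 ≤ snr ^ (2 : ℝ) := Real.one_le_rpow hsnr.le (by norm_num)
    have hs₂ : 1 ≤ snr ^ (3 : ℝ) := Real.one_le_rpow hsnr.le (by norm_num)
    have h₁ : Real.log (snr ^ (2 : ℝ)) = 2 * Real.log snr := Real.log_rpow hs0 _
    have h₂ : Real.log (snr ^ (3 : ℝ)) = 3 * Real.log snr := Real.log_rpow hs0 _
    have hopt : optP1 3 { sr := ![4, 1], rd := ![2, 3] } snr =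
        sSup {r | ∃ p, Feasible 3 p ∧ r = min (psi1 3 (snr ^ (2 : ℝ)) (snr ^ (3 : ℝ)) p)
          (2 * (Real.log snr / Real.log 2) + psi2 3 (snr ^ (2 : ℝ)) (snr ^ (3 : ℝ)) p)} := by
      simp only [optP1, Matrix.cons_val_zero, Matrix.cons_val_one, Real.rpow_one, Real.logb]
      norm_num only [Nat.cast_ofNat]
    -- Needed for the lower bound too: the real supremum of an unbounded set is zero by convention.
    have hub : ∀ r ∈ {r | ∃ p, Feasible 3 p ∧ r = min (psi1 3 (snr ^ (2 : ℝ)) (snr ^ (3 : ℝ)) p)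
          (2 * (Real.log snr / Real.log 2) + psi2 3 (snr ^ (2 : ℝ)) (snr ^ (3 : ℝ)) p)},
        r ≤ (14 / 3 * Real.log snr + C) / Real.log 2 := by
      rintro r ⟨p, hp, rfl⟩
      exact hp.min_objective_le hs₁ hs₂ h₁ h₂ hl.le
    have hlow : 14 / 3 * Real.log snr / Real.log 2 ≤
        optP1 3 { sr := ![4, 1], rd := ![2, 3] } snr := by
      rw [hopt]
      exact (le_min_objective_mixedLaw hs₁ hs₂ h₁ h₂).trans
        (le_csSup ⟨_, hub⟩ ⟨mixedLaw, feasible_mixedLaw, rfl⟩)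
    have hup : optP1 3 { sr := ![4, 1], rd := ![2, 3] } snr ≤
        (14 / 3 * Real.log snr + C) / Real.log 2 := by
      rw [hopt]
      exact csSup_le ⟨_, mixedLaw, feasible_mixedLaw, rfl⟩ hub
    -- The first cut has exponent `2 * 4 = 8`, so it does not bind.
    have hfirst : 14 / 3 * Real.log snr / Real.log 2 ≤
        (((3 : ℕ) : ℝ) - 1) * Real.logb 2 (snr ^ (4 : ℝ)) := by
      rw [Real.logb, Real.log_rpow hs0, ← mul_div_assoc]
      refine div_le_div_of_nonneg_right ?_ hlog2.le
      push_cast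
      linarith
    have hlb : 0 < Real.logb 2 snr := div_pos hl hlog2
    constructor
    · rw [le_div_iff₀ hlb, upperBound, Real.logb, ← mul_div_assoc]
      exact le_min hfirst hlow
    · rw [div_le_iff₀ hlb, upperBound]
      refine (min_le_right _ _).trans (hup.trans (le_of_eq ?_))
      rw [Real.logb]
      field_simp
  have hlim : Tendsto (fun snr : ℝ => 14 / 3 + C / Real.log snr) atTop (𝓝 (14 / 3)) := by
    simpa using (Real.tendsto_log_atTop.const_div_atTop C).const_add (14 / 3)
  exact tendsto_of_tendsto_of_tendsto_of_le_of_le' tendsto_const_nhds hlim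
    (hbounds.mono fun _ h => h.1) (hbounds.mono fun _ h => h.2)

end Diamond

end

theorem mainTheorem8 (γ : Diamond.LinkExponents)
    (hγ : γ = { sr := ![4, 1], rd := ![2, 3] }) :
    Tendsto (fun snr : ℝ => Diamond.upperBound 3 γ snr / Real.logb 2 snr) atTop (𝓝 (14 / 3)) ∧
    3 * Diamond.gDoF 3 γ (fun _ _ c => c.SingleRelayTraining) ≤ 4 ∧
    3 * Diamond.gDoF 3 γ (fun _ _ c => c.TwoRelayTraining) ≤ 3 ∧
    3 * Diamond.gDoF 3 γ (fun _ _ c => c.StandardTraining) < ENNReal.ofReal (14 / 3) ∧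
    3 * Diamond.gDoF 3 γ (fun _ _ c => c.RelaySelection) ≤ 4 ∧
    3 * Diamond.gDoF 3 γ (fun _ _ c => c.RelaySelection) < ENNReal.ofReal (14 / 3) := by
  have h0 : Diamond.ConverseBound 3 γ (fun _ _ c => c.Silent 0) 4 :=
    (Diamond.converseBound_silent_zero γ (by simp [hγ])).mono (fun _ _ _ h => h)
      (by simp [hγ]; norm_num)
  have h1 : Diamond.ConverseBound 3 γ (fun _ _ c => c.Training {0}) 4 :=
    (Diamond.converseBound_training γ {0} (Γ := 2) (by norm_num) (by simp [hγ])).mono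
      (fun _ _ _ h => h) (by norm_num)
  have h2 : Diamond.ConverseBound 3 γ (fun _ _ c => c.TwoRelayTraining) 3 :=
    (Diamond.converseBound_training γ Finset.univ (Γ := 3) (by norm_num)
      (by simp [hγ, Fin.forall_fin_two]; norm_num)).mono (fun _ _ _ h => h) (by norm_num)
  have hsingle : Diamond.ConverseBound 3 γ (fun _ _ c => c.SingleRelayTraining) 4 := by
    -- Training through relay 2 alone is covered by the source cut, since relay 1 is then silent.
    refine (h0.or h1).mono (fun n M c h => ?_) le_rfl
    obtain ⟨i, hi⟩ := h
    fin_cases i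
    · exact Or.inr hi
    · exact Or.inl (hi.1 0 (by simp))
  have hstd : Diamond.ConverseBound 3 γ (fun _ _ c => c.StandardTraining) 4 :=
    hsingle.or (h2.mono (fun _ _ _ h => h) (by norm_num))
  have hsel : Diamond.ConverseBound 3 γ (fun _ _ c => c.RelaySelection) 4 := by
    have h3 : Diamond.ConverseBound 3 γ (fun _ _ c => c.Noncoherent ∧ c.Silent 1) 4 :=
      (Diamond.converseBound_noncoherent (by norm_num) γ (by simp [hγ])).mono (fun _ _ _ h => h)
        (by simp [hγ]; norm_num)
    refine (h0.or h3).mono (fun n M c h => ?_) le_rfl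
    obtain ⟨hn, i, hi⟩ := h
    fin_cases i
    · exact Or.inl hi
    · exact Or.inr ⟨hn, hi⟩
  have hlt : (4 : ENNReal) < ENNReal.ofReal (14 / 3) := by
    rw [← ENNReal.ofReal_ofNat, ENNReal.ofReal_lt_ofReal_iff (by norm_num)]
    norm_num
  have e1 := hsingle.mul_gDoF_le (by norm_num) (by norm_num)
  have e2 := h2.mul_gDoF_le (by norm_num) (by norm_num)
  have e3 := hstd.mul_gDoF_le (by norm_num) (by norm_num)
  have e4 := hsel.mul_gDoF_le (by norm_num) (by norm_num)
  simp only [ENNReal.ofReal_ofNat, Nat.cast_ofNat] at e1 e2 e3 e4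
  exact ⟨hγ ▸ Diamond.tendsto_upperBound, e1, e2, e3.trans_lt hlt, e4, e4.trans_lt hlt⟩
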